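/- Let $p \in [1,2]$, let $X$ be a real random variable with an arbitrary distribution, let $Z \sim \mathcal{N}(0,1)$ be independent of $X$, and let $Y = X + Z$. Call a measurable function $f : \mathbb{R} \to \mathbb{R}$ an optimal Bayesian estimator under $L^p$ loss if $\mathbb{E}[|X - f(Y)|^p] \le \mathbb{E}[|X - g(Y)|^p]$ for every measurable $g : \mathbb{R} \to \mathbb{R}$ (expectations in $[0,\infty]$). Then some linear function $y \mapsto a y$ with $a \in \mathbb{R}$ is an optimal Bayesian estimator if and only if $X$ is a centered Gaussian, where the point mass at $0$ counts as the Gaussian with variance $0$. More precisely, for every $a \in \mathbb{R}$, the function $y \mapsto a y$ is an optimal Bayesian estimator if and only if $0 \le a < 1$ and $X \sim \mathcal{N}\left(0, \frac{a}{1-a}\right)$. -/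

import Mathlib

open MeasureTheory ProbabilityTheory
open scoped NNReal ENNReal

/-- The Bayesian `L^p` risk `E[|X - g(Y)|^p]`, in `[0, ∞]`, of estimating `X` by `g(Y)`. -/
noncomputable def bayesRisk {Ω : Type*} [MeasurableSpace Ω] (μ : Measure Ω) (p : ℝ)
    (X Y : Ω → ℝ) (g : ℝ → ℝ) : ℝ≥0∞ :=
  ∫⁻ ω, ENNReal.ofReal (|X ω - g (Y ω)| ^ p) ∂μ

/-- `f` is an optimal Bayesian estimator of `X` from the observation `Y` under the `L^p` loss:
it is measurable and minimizes the risk among all measurable estimators. -/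
def IsOptimalEstimator {Ω : Type*} [MeasurableSpace Ω] (μ : Measure Ω) (p : ℝ)
    (X Y : Ω → ℝ) (f : ℝ → ℝ) : Prop :=
  Measurable f ∧ ∀ g : ℝ → ℝ, Measurable g → bayesRisk μ p X Y f ≤ bayesRisk μ p X Y g

/-! Write `P` for the law of `X`, `φ` for the standard Gaussian density and `K u = signPow (p - 1) u
* exp (-u² / (2a))`. Perturbing the estimator `a * y` by `ε * k y`, with `k` supported on an
arbitrary measurable set, gives for almost every `y` the first order condition `|∫ φ(y - x) signPow
(p - 1) (x - a y) dP(x)| ≤ φ(y - a y) P{a y}` (`abs_integral_signPow_mul_gaussianPDFReal_le`). The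
right-hand side comes from the kink of `|·|^p` at `0` when `p = 1`; keeping it for every `p` avoids
a case split.

Let `a > 0`. Atoms are countable, so the right-hand side vanishes for almost every `y`. Completing
the square splits `φ(y - x)` into `exp (-(x - a y)² / (2a))`, a factor `e x = exp ((1 - a) x² /
(2a))` and a function of `y`. Hence `ν = e • P` satisfies `∫ K (x - a y) dν(x) = 0` for almost every
`y`. Since `p ≤ 2`, the factor `|x|^(p - 2)` is a mixture of Gaussians in `x`, so `K = -L'` with `L`
itself a Gaussian mixture (`exists_primitive_kernel`). Thus the translates of `L` all have the same
`ν`-integral, while `L` has a positive Fourier transform. A Wiener-type argument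
(`eq_smul_volume_of_translate_const`) makes `ν` a multiple of Lebesgue measure, so `P` has density
proportional to `exp (-(1 - a) x² / (2a))`. Finite mass then forces `a < 1` and identifies the
variance.

For `a = 0`, exponentially tilted moments of `P` stay bounded, which excludes mass off `0`. For `a <
0`, averaging over `Z` and `-Z` shows that the zero estimator is strictly better, unless `X = 0`,
which is excluded as well. Conversely, for the stated Gaussian prior the error `X - a Y` is
symmetric and independent of `Y`, so convexity of `|·|^p` makes every further correction harmful. -/

/-! ### Measures are determined by their integrals against band-limited functions -/

section BandLimited

open scoped FourierTransform SchwartzMap ContDiff ComplexConjugate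

/-- Modulating a Fourier transform amounts to translating the original function. -/
lemma fourier_comp_sub_right (f : ℝ → ℂ) (s x : ℝ) :
    𝓕 (fun t => f (t - s)) x = Complex.exp ((-2 * Real.pi * s * x : ℝ) * Complex.I) * 𝓕 f x := by
  rw [Real.fourier_real_eq_integral_exp_smul, Real.fourier_real_eq_integral_exp_smul,
    ← integral_const_mul, ← integral_add_right_eq_self _ s]
  congr 1 with v
  rw [add_sub_cancel_right, smul_eq_mul, smul_eq_mul, ← mul_assoc, ← Complex.exp_add]
  congr 2
  push_cast
  ring

/-- The Fourier transform of a real even function is real. -/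
lemma conj_fourier_ofReal_of_even {f : ℝ → ℝ} (hf : ∀ x, f (-x) = f x) (x : ℝ) :
    conj (𝓕 (fun t => (f t : ℂ)) x) = 𝓕 (fun t => (f t : ℂ)) x := by
  rw [Real.fourier_real_eq_integral_exp_smul, ← integral_conj, ← integral_neg_eq_self]
  congr 1 with v
  rw [smul_eq_mul, smul_eq_mul, map_mul, ← Complex.exp_conj, map_mul, Complex.conj_ofReal,
    Complex.conj_ofReal, Complex.conj_I, hf]
  congr 2
  push_cast
  ring

/-- A smooth bump supported near `0` has a Fourier transform that does not vanish on a prescribed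
bounded interval. -/
lemma fourier_ne_zero_of_support {f : ℝ → ℝ} {r x : ℝ} (hr : |x| * r ≤ 1 / 8)
    (hf0 : ∀ t, 0 ≤ f t) (hfs : ∀ t, r < |t| → f t = 0) (hfi : Integrable f)
    (hpos : 0 < ∫ t, f t) : 𝓕 (fun t => (f t : ℂ)) x ≠ 0 := by
  intro h0
  -- On the support the phase is at most `2π / 8 < π / 3`, so the cosine is at least `1 / 2` and the
  -- real part of the transform is at least half the mass of `f`.
  have hbd : ∀ t, f t * (1 / 2) ≤ Real.cos (-2 * Real.pi * t * x) * f t := by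
    intro t
    by_cases ht : r < |t|
    · simp [hfs t ht]
    · push Not at ht
      have h1 : |(-2 * Real.pi * t * x)| ≤ Real.pi / 3 := by
        have : |t| * |x| ≤ 1 / 8 := by nlinarith [abs_nonneg x]
        rw [abs_mul, abs_mul, abs_mul, abs_of_pos Real.pi_pos]
        norm_num
        nlinarith [Real.pi_pos]
      have h2 : 1 / 2 ≤ Real.cos (-2 * Real.pi * t * x) := by
        rw [← Real.cos_abs, ← Real.cos_pi_div_three]
        exact Real.cos_le_cos_of_nonneg_of_le_pi (abs_nonneg _)
          (by linarith [Real.pi_pos]) h1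
      nlinarith [hf0 t]
  have hint : Integrable (fun t => Real.cos (-2 * Real.pi * t * x) * f t) := by
    refine hfi.bdd_mul (c := 1) (by fun_prop) ?_
    exact Filter.Eventually.of_forall fun t => by
      simpa using Real.abs_cos_le_one (-2 * Real.pi * t * x)
  have hintc : Integrable (fun v : ℝ =>
      Complex.exp ((-2 * Real.pi * v * x : ℝ) * Complex.I) • (f v : ℂ)) := by
    refine hfi.ofReal.bdd_mul (c := 1) (by fun_prop) ?_
    exact Filter.Eventually.of_forall fun t => by rw [Complex.norm_exp_ofReal_mul_I]
  have hre : (𝓕 (fun t => (f t : ℂ)) x).re = ∫ t, Real.cos (-2 * Real.pi * t * x) * f t := by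
    rw [Real.fourier_real_eq_integral_exp_smul]
    have := integral_re (𝕜 := ℂ) hintc
    simp only [RCLike.re_to_complex] at this
    rw [← this]
    congr 1 with t
    rw [smul_eq_mul, Complex.re_mul_ofReal, Complex.exp_ofReal_mul_I_re]
  have := integral_mono (hfi.mul_const (1 / 2)) hint hbd
  rw [← hre, h0, integral_mul_const, Complex.zero_re] at this
  linarith

/-- Measures of temperate growth agreeing on Fourier transforms of test functions are equal. -/
theorem measure_eq_of_integral_fourier_eq {μ ν : Measure ℝ} [μ.HasTemperateGrowth]
    [ν.HasTemperateGrowth]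
    (h : ∀ ψ : 𝓢(ℝ, ℂ), HasCompactSupport ψ → ∫ x, 𝓕 ψ x ∂μ = ∫ x, 𝓕 ψ x ∂ν) : μ = ν := by
  -- the squared Fourier transform of an even bump gives finite measures with equal charFun
  have key : ∀ n : ℕ, μ.restrict (Set.Icc (-(n : ℝ)) n) = ν.restrict (Set.Icc (-(n : ℝ)) n) := by
    intro n
    -- The bump is so narrow that `|x| * r ≤ 1 / 8` on `[-n, n]`, as `fourier_ne_zero_of_support`
    -- requires.
    set r : ℝ := 1 / (8 * (n + 1)) with hr
    have hrpos : 0 < r := by positivity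
    let b : ContDiffBump (0 : ℝ) := ⟨r / 2, r, by positivity, by linarith⟩
    have hbc : HasCompactSupport (fun t => (b t : ℂ)) :=
      b.hasCompactSupport.comp_left (g := fun x : ℝ => (x : ℂ)) (by simp)
    have hbs : ContDiff ℝ ∞ (fun t => (b t : ℂ)) := Complex.ofRealCLM.contDiff.comp b.contDiff
    let ψ : 𝓢(ℝ, ℂ) := hbc.toSchwartzMap hbs
    have hψ : (ψ : ℝ → ℂ) = fun t => (b t : ℂ) := rfl
    let F : ℝ → ℂ := 𝓕 (fun t => (b t : ℂ))
    have hFψ : ∀ x, 𝓕 ψ x = F x := fun x => by rw [SchwartzMap.fourier_coe, hψ]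
    have hFc : Continuous F := by
      have : F = 𝓕 ψ := by ext x; rw [hFψ]
      rw [this]; exact (𝓕 ψ).continuous
    have hFconj : ∀ x, F x * F x = ((‖F x‖ ^ 2 : ℝ) : ℂ) := by
      intro x
      have := Complex.conj_mul' (F x)
      rw [conj_fourier_ofReal_of_even (fun t => b.neg t)] at this
      rw [this]; push_cast; rfl
    have hF0 : ∀ x ∈ Set.Icc (-(n : ℝ)) n, F x ≠ 0 := by
      intro x hx
      refine fourier_ne_zero_of_support (r := r) ?_ (fun t => b.nonneg) ?_ b.integrable
        b.integral_pos
      · have : |x| ≤ n := abs_le.mpr hx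
        rw [hr, mul_one_div, div_le_div_iff₀ (by positivity) (by norm_num)]
        nlinarith
      · intro t ht
        exact b.zero_of_le_dist (by simpa using ht.le)
    let G : ℝ → ℝ≥0∞ := fun x => ENNReal.ofReal (‖F x‖ ^ 2)
    have hG : Measurable G := by fun_prop
    -- products are Fourier transforms of compactly supported functions
    have hprod : ∀ s : ℝ, ∃ φ : 𝓢(ℝ, ℂ), HasCompactSupport φ ∧ ∀ x, 𝓕 φ x =
        Complex.exp ((-2 * Real.pi * s * x : ℝ) * Complex.I) * ((‖F x‖ ^ 2 : ℝ) : ℂ) := by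
      intro s
      have hc : HasCompactSupport (fun t => (b (t - s) : ℂ)) := by
        have := hbc.comp_homeomorph (Homeomorph.subRight s)
        exact this
      have hsm : ContDiff ℝ ∞ (fun t => (b (t - s) : ℂ)) :=
        hbs.comp (contDiff_id.sub contDiff_const)
      let ψs : 𝓢(ℝ, ℂ) := hc.toSchwartzMap hsm
      -- The bump convolved with its translate by `s`: the transform is a modulation of `F * F`,
      -- which is `‖F‖ ^ 2` because `F` is real.
      refine ⟨SchwartzMap.convolution (ContinuousLinearMap.mul ℂ ℂ) ψs ψ, ?_, ?_⟩
      · have : (SchwartzMap.convolution (ContinuousLinearMap.mul ℂ ℂ) ψs ψ : ℝ → ℂ) =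
            MeasureTheory.convolution ψs ψ (ContinuousLinearMap.mul ℂ ℂ) volume := by
          ext x; exact SchwartzMap.convolution_apply _ _ _ _
        rw [this]
        exact HasCompactSupport.convolution _ hc hbc
      · intro x
        rw [SchwartzMap.fourier_convolution, SchwartzMap.pairing_apply_apply, hFψ, ← hFconj,
          ContinuousLinearMap.mul_apply', ← mul_assoc]
        congr 1
        rw [SchwartzMap.fourier_coe]
        exact fourier_comp_sub_right (fun t => (b t : ℂ)) s x
    have hGfin : ∀ (m : Measure ℝ) [m.HasTemperateGrowth], IsFiniteMeasure (m.withDensity G) := by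
      intro m _
      obtain ⟨φ, -, hφ⟩ := hprod 0
      have hi : Integrable (fun x => ‖F x‖ ^ 2) m := by
        refine ((𝓕 φ).integrable (μ := m)).norm.congr (Filter.Eventually.of_forall fun x => ?_)
        simp only [hφ]
        simp
      exact isFiniteMeasure_withDensity_ofReal hi.2
    have hchar : ∀ (m : Measure ℝ) (t : ℝ), charFun (m.withDensity G) t =
        ∫ x, Complex.exp (t * x * Complex.I) * ((‖F x‖ ^ 2 : ℝ) : ℂ) ∂m := by
      intro m t
      rw [charFun_apply_real, integral_withDensity_eq_integral_toReal_smul hG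
        (Filter.Eventually.of_forall fun x => ENNReal.ofReal_lt_top)]
      congr 1 with x
      rw [ENNReal.toReal_ofReal (by positivity), Complex.real_smul, mul_comm]
    have heq : μ.withDensity G = ν.withDensity G := by
      have := hGfin μ
      have := hGfin ν
      refine Measure.ext_of_charFun (funext fun t => ?_)
      -- This translation converts the `2π`-normalized Fourier kernel into the `exp (i t x)` of
      -- `charFun`.
      obtain ⟨φ, hφc, hφ⟩ := hprod (-t / (2 * Real.pi))
      have hφ' : ∀ x, 𝓕 φ x = Complex.exp (t * x * Complex.I) * ((‖F x‖ ^ 2 : ℝ) : ℂ) := by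
        intro x
        rw [hφ]
        congr 3
        have : (-2 * Real.pi * (-t / (2 * Real.pi)) * x : ℝ) = t * x := by
          field_simp
        rw [this]; push_cast; rfl
      rw [hchar, hchar]
      have := h φ hφc
      simpa only [hφ'] using this
    -- The density `G` does not vanish on `[-n, n]`, so it can be divided out there.
    have hrec : ∀ (m : Measure ℝ) (s : Set ℝ), MeasurableSet s → s ⊆ Set.Icc (-(n : ℝ)) n →
        m s = ∫⁻ x in s, (G x)⁻¹ ∂(m.withDensity G) := by
      intro m s hs hsub
      rw [restrict_withDensity hs, lintegral_withDensity_eq_lintegral_mul _ hG (g := fun x => (G x)⁻¹) hG.inv]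
      rw [← setLIntegral_one]
      refine setLIntegral_congr_fun hs fun x hx => ?_
      simp only [Pi.mul_apply]
      rw [ENNReal.mul_inv_cancel]
      · have := hF0 x (hsub hx)
        simp only [G, ne_eq, ENNReal.ofReal_eq_zero, not_le]
        positivity
      · exact ENNReal.ofReal_ne_top
    ext s hs
    rw [Measure.restrict_apply hs, Measure.restrict_apply hs,
      hrec μ _ (hs.inter measurableSet_Icc) Set.inter_subset_right,
      hrec ν _ (hs.inter measurableSet_Icc) Set.inter_subset_right, heq]
  refine (Measure.ext_iff_of_iUnion_eq_univ (s := fun n : ℕ => Set.Icc (-(n : ℝ)) n) ?_).2 key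
  refine Set.eq_univ_of_forall fun x => Set.mem_iUnion.2 ?_
  obtain ⟨n, hn⟩ := exists_nat_ge |x|
  exact ⟨n, abs_le.mp hn⟩

end BandLimited

/-! ### A Wiener-type theorem for positive measures -/

section Wiener

open scoped FourierTransform SchwartzMap ContDiff ComplexConjugate

/-- Integrating the bound in `η` against the integrable weight `w = (1 + |η|)⁻²` and exchanging
integrals bounds `∫ (L ∗ w) dν`; and `L ∗ w` dominates a multiple of `w`, since `L` is bounded below
on `[-1, 1]`. -/
lemma hasTemperateGrowth_of_lintegral_translate_le {L : ℝ → ℝ} (hLc : Continuous L)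
    (hL0 : ∀ u, 0 < L u) {ν : Measure ℝ} [SFinite ν] {C : ℝ≥0∞} (hC : C ≠ ⊤)
    (h : ∀ η, ∫⁻ x, ENNReal.ofReal (L (x - η)) ∂ν ≤ C) : ν.HasTemperateGrowth := by
  obtain ⟨u₀, -, hu₀⟩ := (isCompact_Icc (a := (-1 : ℝ)) (b := 1)).exists_isMinOn
    ⟨0, by simp⟩ hLc.continuousOn
  set δ := L u₀
  have hδ : 0 < δ := hL0 u₀
  let w : ℝ → ℝ := fun x => (1 + ‖x‖) ^ (-((2 : ℕ) : ℝ))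
  have hw : ∀ x, w x = ((1 + |x|) ^ 2)⁻¹ := fun x => by
    simp only [w, Real.norm_eq_abs]
    rw [Real.rpow_neg (by positivity), Real.rpow_natCast]
  have hw0 : ∀ x, 0 < w x := fun x => by rw [hw]; positivity
  have hwm : Measurable w := by fun_prop
  have hwi : Integrable w volume := by
    refine integrable_one_add_norm ?_
    norm_num
  refine ⟨⟨2, ?_⟩⟩
  change Integrable w ν
  refine ⟨hwm.aestronglyMeasurable, ?_⟩
  rw [hasFiniteIntegral_iff_ofReal (Filter.Eventually.of_forall fun x => (hw0 x).le)]
  -- On the interval of length `2` around `x`, `L ≥ δ` and `w` drops by a factor of at most `4`,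
  -- whence `2 * δ / 4 = δ / 2`.
  have hpt : ∀ x, ENNReal.ofReal (δ / 2) * ENNReal.ofReal (w x) ≤
      ∫⁻ η, ENNReal.ofReal (L (x - η)) * ENNReal.ofReal (w η) := by
    intro x
    calc ENNReal.ofReal (δ / 2) * ENNReal.ofReal (w x)
        = ∫⁻ _ in Set.Icc (x - 1) (x + 1), ENNReal.ofReal (δ * (w x / 4)) := by
          rw [setLIntegral_const, Real.volume_Icc, ← ENNReal.ofReal_mul (by positivity),
            ← ENNReal.ofReal_mul (by have := hw0 x; positivity)]
          congr 1; ring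
      _ ≤ ∫⁻ η in Set.Icc (x - 1) (x + 1), ENNReal.ofReal (L (x - η)) * ENNReal.ofReal (w η) := by
          refine setLIntegral_mono' measurableSet_Icc fun η hη => ?_
          rw [← ENNReal.ofReal_mul (hL0 _).le]
          refine ENNReal.ofReal_le_ofReal (mul_le_mul ?_ ?_ (by have := hw0 x; positivity)
            (hL0 _).le)
          · exact hu₀ ⟨by linarith [hη.2], by linarith [hη.1]⟩
          · rw [hw, hw, div_eq_mul_inv, ← mul_inv]
            refine inv_anti₀ (by positivity) ?_
            have h1 : |η| ≤ |x| + 1 := by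
              have : |η - x| ≤ 1 := abs_le.mpr ⟨by linarith [hη.1], by linarith [hη.2]⟩
              have h2 := abs_add_le (η - x) x
              rw [sub_add_cancel] at h2
              linarith
            nlinarith [abs_nonneg η, abs_nonneg x]
      _ ≤ _ := setLIntegral_le_lintegral _ _
  have htot : ENNReal.ofReal (δ / 2) * ∫⁻ x, ENNReal.ofReal (w x) ∂ν < ⊤ := by
    rw [← lintegral_const_mul _ hwm.ennreal_ofReal]
    calc _ ≤ ∫⁻ x, ∫⁻ η, ENNReal.ofReal (L (x - η)) * ENNReal.ofReal (w η) ∂volume ∂ν :=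
          lintegral_mono hpt
      _ = ∫⁻ η, ∫⁻ x, ENNReal.ofReal (L (x - η)) * ENNReal.ofReal (w η) ∂ν := by
          refine lintegral_lintegral_swap (Measurable.aemeasurable ?_)
          have := hLc.measurable
          unfold Function.uncurry
          fun_prop
      _ ≤ ∫⁻ η, C * ENNReal.ofReal (w η) := by
          refine lintegral_mono fun η => ?_
          simp only
          rw [lintegral_mul_const _ (by have := hLc.measurable; fun_prop)]
          gcongr
          exact h η
      _ = C * ∫⁻ η, ENNReal.ofReal (w η) := lintegral_const_mul _ hwm.ennreal_ofReal
      _ < ⊤ := ENNReal.mul_lt_top hC.lt_top hwi.lintegral_lt_top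
  exact (ENNReal.mul_lt_top_iff.1 htot).elim (fun h => h.2) fun h => by
    rcases h with h | h
    · simp at h; linarith
    · rw [h]; simp

/-- Convolving `𝓕 k` with `L` multiplies `k` by the (reflected) Fourier transform of `L`. -/
lemma integral_mul_fourier_eq {L : ℝ → ℝ} (hLi : Integrable L) (k : 𝓢(ℝ, ℂ)) (x : ℝ) :
    ∫ η, (L (x - η) : ℂ) * 𝓕 k η = 𝓕 (fun t => 𝓕 (fun u => (L u : ℂ)) (-t) * k t) x := by
  have h1 : ∫ η, (L (x - η) : ℂ) * 𝓕 k η = ∫ u, (L u : ℂ) * 𝓕 k (x - u) := by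
    rw [← integral_sub_left_eq_self _ volume x]
    congr 1 with u
    rw [sub_sub_cancel]
  have h2 : ∀ u, (L u : ℂ) * 𝓕 k (x - u) = ∫ t, (L u : ℂ) *
      (Complex.exp ((-2 * Real.pi * t * (x - u) : ℝ) * Complex.I) • k t) := fun u => by
    rw [SchwartzMap.fourier_coe, Real.fourier_real_eq_integral_exp_smul, integral_const_mul]
  rw [h1]
  simp_rw [h2]
  rw [integral_integral_swap, Real.fourier_real_eq_integral_exp_smul]
  · congr 1 with t
    rw [Real.fourier_real_eq_integral_exp_smul]
    simp only [smul_eq_mul]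
    rw [← mul_assoc, mul_comm _ (k t), ← integral_const_mul, ← integral_const_mul]
    congr 1 with u
    have : Complex.exp ((-2 * Real.pi * t * (x - u) : ℝ) * Complex.I) =
        Complex.exp ((-2 * Real.pi * t * x : ℝ) * Complex.I) *
        Complex.exp ((-2 * Real.pi * u * -t : ℝ) * Complex.I) := by
      rw [← Complex.exp_add]
      congr 1
      push_cast
      ring
    rw [this]
    ring
  · have hp : Integrable (fun z : ℝ × ℝ => (L z.1 : ℂ) * k z.2) (volume.prod volume) :=
      Integrable.mul_prod hLi.ofReal k.integrable
    have : Integrable (fun z : ℝ × ℝ => Complex.exp ((-2 * Real.pi * z.2 * (x - z.1) : ℝ) *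
        Complex.I) * ((L z.1 : ℂ) * k z.2)) (volume.prod volume) := by
      refine hp.bdd_mul (c := 1) (Continuous.aestronglyMeasurable (by fun_prop)) ?_
      exact Filter.Eventually.of_forall fun t => by rw [Complex.norm_exp_ofReal_mul_I]
    refine this.congr (Filter.Eventually.of_forall fun z => ?_)
    simp only [Function.uncurry, smul_eq_mul]
    ring

/-- Averaging a test function against a measure whose convolution with `L` is constant. -/
lemma integral_convolution_of_translate_const {L : ℝ → ℝ} (hLc : Continuous L)
    (hL0 : ∀ u, 0 < L u) {ν : Measure ℝ} [SFinite ν] {C : ℝ≥0}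
    (h : ∀ η, ∫⁻ x, ENNReal.ofReal (L (x - η)) ∂ν = C) {f : ℝ → ℂ} (hf : Integrable f)
    (hfc : Continuous f) :
    ∫ x, ∫ η, (L (x - η) : ℂ) * f η ∂volume ∂ν = C * ∫ η, f η := by
  have hi : ∀ η, Integrable (fun x => L (x - η)) ν := fun η => by
    refine ⟨Continuous.aestronglyMeasurable (by fun_prop), ?_⟩
    rw [hasFiniteIntegral_iff_ofReal (Filter.Eventually.of_forall fun x => (hL0 _).le), h]
    exact ENNReal.coe_lt_top
  have hv : ∀ η, ∫ x, L (x - η) ∂ν = C := fun η => by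
    rw [integral_eq_lintegral_of_nonneg_ae (Filter.Eventually.of_forall fun x => (hL0 _).le)
      (hi η).aestronglyMeasurable, h]
    rfl
  rw [integral_integral_swap]
  · rw [← integral_const_mul]
    congr 1 with η
    rw [integral_mul_const, integral_complex_ofReal, hv]
  · rw [integrable_prod_iff' (Continuous.aestronglyMeasurable (by
      unfold Function.uncurry; fun_prop))]
    refine ⟨Filter.Eventually.of_forall fun η => ((hi η).ofReal (𝕜 := ℂ)).mul_const (f η), ?_⟩
    refine (hf.norm.const_mul (C : ℝ)).congr (Filter.Eventually.of_forall fun η => ?_)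
    simp only [Function.uncurry, norm_mul, Complex.norm_real]
    rw [integral_mul_const]
    simp_rw [Real.norm_of_nonneg (hL0 _).le]
    rw [hv]

/-- A Wiener-type theorem: a measure whose convolution with a positive rapidly decreasing kernel
with nonvanishing Fourier transform is constant, is a multiple of Lebesgue measure. -/
theorem eq_smul_volume_of_translate_const {L : ℝ → ℝ} (hLc : Continuous L)
    (hL0 : ∀ u, 0 < L u) (hLm : ∀ n : ℕ, Integrable (fun u => ‖u‖ ^ n * ‖L u‖))
    (hLF : ∀ t, 𝓕 (fun u => (L u : ℂ)) t ≠ 0) {ν : Measure ℝ} [SFinite ν] {C : ℝ≥0}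
    (h : ∀ η, ∫⁻ x, ENNReal.ofReal (L (x - η)) ∂ν = C) :
    ∃ c : ℝ≥0, ν = c • (volume : Measure ℝ) := by
  have hLi : Integrable L := by
    have := hLm 0
    simp only [pow_zero, one_mul] at this
    exact (integrable_norm_iff hLc.aestronglyMeasurable).1 this
  have hIpos : 0 < ∫ u, L u := by
    rw [integral_pos_iff_support_of_nonneg (fun u => (hL0 u).le) hLi]
    have : Function.support L = Set.univ := Set.eq_univ_of_forall fun u => (hL0 u).ne'
    simp [this]
  -- Forced by the case of Lebesgue measure, against which every translate of `L` integrates to `∫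
  -- L`.
  refine ⟨C / (∫ u, L u).toNNReal, ?_⟩
  set c : ℝ≥0 := C / (∫ u, L u).toNNReal with hc
  have hcr : (c : ℝ) * ∫ u, L u = C := by
    rw [hc, NNReal.coe_div, Real.coe_toNNReal _ hIpos.le, div_mul_cancel₀ _ hIpos.ne']
  have : ν.HasTemperateGrowth :=
    hasTemperateGrowth_of_lintegral_translate_le hLc hL0 ENNReal.coe_ne_top fun η => (h η).le
  have : (c • (volume : Measure ℝ)).HasTemperateGrowth :=
    ⟨⟨2, (integrable_one_add_norm (by norm_num)).smul_measure_nnreal⟩⟩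
  refine measure_eq_of_integral_fourier_eq fun ψ hψ => ?_
  have hFs : ContDiff ℝ ∞ (fun t => 𝓕 (fun u => (L u : ℂ)) (-t)) := by
    refine ContDiff.comp (g := 𝓕 (fun u => (L u : ℂ))) ?_ contDiff_neg
    exact Real.contDiff_fourier fun n _ => by simpa [Complex.norm_real] using hLm n
  -- Deconvolution: dividing by the transform of `L` is harmless on a compact support, and smooth
  -- because `L` has all moments. Then `𝓕 ψ` is `L` convolved with `𝓕 k`, so its integral depends
  -- only on the constant `C`.
  let k₀ : ℝ → ℂ := fun t => (𝓕 (fun u => (L u : ℂ)) (-t))⁻¹ * ψ t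
  have hk₀c : HasCompactSupport k₀ := hψ.mul_left
  have hk₀s : ContDiff ℝ ∞ k₀ := (hFs.inv fun t => hLF (-t)).mul (ψ.smooth ⊤)
  let k : 𝓢(ℝ, ℂ) := hk₀c.toSchwartzMap hk₀s
  have hconv : ∀ x, ∫ η, (L (x - η) : ℂ) * 𝓕 k η = 𝓕 ψ x := by
    intro x
    rw [integral_mul_fourier_eq hLi, SchwartzMap.fourier_coe]
    have : (fun t => 𝓕 (fun u => (L u : ℂ)) (-t) * k t) = ψ := by
      ext t
      change 𝓕 (fun u => (L u : ℂ)) (-t) * ((𝓕 (fun u => (L u : ℂ)) (-t))⁻¹ * ψ t) = _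
      rw [← mul_assoc, mul_inv_cancel₀ (hLF _), one_mul]
    rw [this]
  have hν := integral_convolution_of_translate_const hLc hL0 h (𝓕 k).integrable (𝓕 k).continuous
  have hvol := integral_convolution_of_translate_const (ν := volume)
    (C := (∫ u, L u).toNNReal) hLc hL0 (fun η => by
      rw [lintegral_sub_right_eq_self (fun x => ENNReal.ofReal (L x)),
        ← ofReal_integral_eq_lintegral_ofReal hLi
          (Filter.Eventually.of_forall fun u => (hL0 u).le)]
      rfl) (𝓕 k).integrable (𝓕 k).continuous
  simp_rw [hconv] at hν hvol
  rw [hν, integral_smul_nnreal_measure, hvol, Real.coe_toNNReal _ hIpos.le, NNReal.smul_def,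
    Complex.real_smul, ← mul_assoc, ← Complex.ofReal_mul, hcr]

end Wiener

/-! ### The kernel as the derivative of a Gaussian mixture -/

section GaussianMixture

open scoped FourierTransform

/-- The odd power `sign u * |u| ^ q`. -/
noncomputable def signPow (q u : ℝ) : ℝ := Real.sign u * |u| ^ q

lemma integral_pos_of_forall_pos {m : Measure ℝ} {f : ℝ → ℝ} (hm0 : m ≠ 0) (hf : Integrable f m)
    (hpos : ∀ᵐ σ ∂m, 0 < f σ) : 0 < ∫ σ, f σ ∂m := by
  rw [integral_pos_iff_support_of_nonneg_ae (hpos.mono fun σ h => h.le) hf]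
  have : m (Function.support f) = m Set.univ := by
    refine measure_congr ?_
    filter_upwards [hpos] with σ h
    exact propext ⟨fun _ => trivial, fun _ => h.ne'⟩
  rw [this]
  exact Measure.measure_univ_pos.2 hm0

variable {m : Measure ℝ} [IsFiniteMeasure m] {β : ℝ}

/-- The mixture of the Gaussian functions `exp (-σ u²)` according to `m`. -/
noncomputable def gaussianMixture (m : Measure ℝ) (u : ℝ) : ℝ := ∫ σ, Real.exp (-σ * u ^ 2) ∂m

lemma integrable_exp_neg_mul_sq_mixture (hβ : 0 < β) (hm : ∀ᵐ σ ∂m, β ≤ σ) (u : ℝ) :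
    Integrable (fun σ => Real.exp (-σ * u ^ 2)) m := by
  refine Integrable.of_bound (Continuous.aestronglyMeasurable (by fun_prop)) 1 ?_
  filter_upwards [hm] with σ hσ
  rw [Real.norm_of_nonneg (Real.exp_pos _).le, Real.exp_le_one_iff]
  nlinarith [sq_nonneg u]

lemma continuous_gaussianMixture (hβ : 0 < β) (hm : ∀ᵐ σ ∂m, β ≤ σ) :
    Continuous (gaussianMixture m) := by
  refine continuous_of_dominated (bound := fun _ => 1)
    (fun u => (integrable_exp_neg_mul_sq_mixture hβ hm u).aestronglyMeasurable) (fun u => ?_)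
    (integrable_const _) (Filter.Eventually.of_forall fun σ => by fun_prop)
  filter_upwards [hm] with σ hσ
  rw [Real.norm_of_nonneg (Real.exp_pos _).le, Real.exp_le_one_iff]
  nlinarith [sq_nonneg u]

lemma gaussianMixture_pos (hβ : 0 < β) (hm : ∀ᵐ σ ∂m, β ≤ σ) (hm0 : m ≠ 0) (u : ℝ) :
    0 < gaussianMixture m u :=
  integral_pos_of_forall_pos hm0 (integrable_exp_neg_mul_sq_mixture hβ hm u)
    (Filter.Eventually.of_forall fun _ => Real.exp_pos _)

lemma gaussianMixture_le (hβ : 0 < β) (hm : ∀ᵐ σ ∂m, β ≤ σ) (u : ℝ) :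
    gaussianMixture m u ≤ m.real Set.univ * Real.exp (-β * u ^ 2) := by
  have h := integral_mono_ae (integrable_exp_neg_mul_sq_mixture hβ hm u)
    (integrable_const (Real.exp (-β * u ^ 2))) (by
      filter_upwards [hm] with σ hσ
      refine Real.exp_le_exp.2 ?_
      nlinarith [sq_nonneg u])
  rwa [integral_const, smul_eq_mul] at h

lemma integrable_pow_mul_gaussianMixture (hβ : 0 < β) (hm : ∀ᵐ σ ∂m, β ≤ σ) (hm0 : m ≠ 0)
    (n : ℕ) : Integrable (fun u => ‖u‖ ^ n * ‖gaussianMixture m u‖) := by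
  have hg : Integrable (fun u : ℝ => u ^ (n : ℝ) * Real.exp (-β * u ^ 2)) :=
    integrable_rpow_mul_exp_neg_mul_sq hβ (by have := n.cast_nonneg (α := ℝ); linarith)
  refine (hg.const_mul (m.real Set.univ)).mono
    (by have := continuous_gaussianMixture hβ hm
        exact Continuous.aestronglyMeasurable (by fun_prop)) ?_
  refine Filter.Eventually.of_forall fun u => ?_
  have h1 := gaussianMixture_le hβ hm u
  have h0 := gaussianMixture_pos hβ hm hm0 u
  rw [Real.rpow_natCast]
  simp only [norm_mul, norm_pow, norm_norm]
  rw [Real.norm_of_nonneg h0.le, Real.norm_of_nonneg (Real.exp_pos _).le,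
    Real.norm_of_nonneg (measureReal_nonneg)]
  calc ‖u‖ ^ n * gaussianMixture m u
      ≤ ‖u‖ ^ n * (m.real Set.univ * Real.exp (-β * u ^ 2)) := by gcongr
    _ = _ := by ring

lemma fourier_exp_neg_mul_sq {σ : ℝ} (hσ : 0 < σ) (t : ℝ) :
    𝓕 (fun u : ℝ => (Real.exp (-σ * u ^ 2) : ℂ)) t =
      ((Real.sqrt (Real.pi / σ) * Real.exp (-Real.pi ^ 2 / σ * t ^ 2) : ℝ) : ℂ) := by
  have hb : 0 < ((σ / Real.pi : ℝ) : ℂ).re := by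
    rw [Complex.ofReal_re]; exact div_pos hσ Real.pi_pos
  have h := congrFun (fourier_gaussian_pi hb) t
  have h1 : (fun x : ℝ => Complex.exp (-(Real.pi : ℂ) * ((σ / Real.pi : ℝ) : ℂ) * x ^ 2)) =
      fun u : ℝ => (Real.exp (-σ * u ^ 2) : ℂ) := by
    ext x
    rw [Complex.ofReal_exp]
    congr 1
    have := Real.pi_ne_zero
    have h2 : -Real.pi * (σ / Real.pi) * x ^ 2 = -σ * x ^ 2 := by field_simp
    rw [← h2]
    push_cast
    ring
  rw [h1] at h
  rw [h, Complex.ofReal_mul, Complex.ofReal_exp]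
  congr 1
  · have h3 : ((1 / 2 : ℂ)) = ((1 / 2 : ℝ) : ℂ) := by push_cast; rfl
    rw [h3, ← Complex.ofReal_cpow (div_pos hσ Real.pi_pos).le, ← Real.sqrt_eq_rpow,
      ← Complex.ofReal_one, ← Complex.ofReal_div, ← Real.sqrt_one,
      ← Real.sqrt_div zero_le_one, one_div_div]
  · congr 1
    have h2 : -Real.pi ^ 2 / σ * t ^ 2 = -Real.pi / (σ / Real.pi) * t ^ 2 := by
      have := Real.pi_ne_zero
      field_simp
    rw [h2]
    push_cast
    ring

/-- Each Gaussian has a strictly positive transform, so averaging over `m` produces no cancellation.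
-/
lemma fourier_gaussianMixture_ne_zero (hβ : 0 < β) (hm : ∀ᵐ σ ∂m, β ≤ σ) (hm0 : m ≠ 0)
    (t : ℝ) : 𝓕 (fun u => (gaussianMixture m u : ℂ)) t ≠ 0 := by
  let r : ℝ → ℝ := fun σ => Real.sqrt (Real.pi / σ) * Real.exp (-Real.pi ^ 2 / σ * t ^ 2)
  let f : ℝ → ℝ → ℂ := fun u σ => Complex.exp ((-2 * Real.pi * u * t : ℝ) * Complex.I) *
    (Real.exp (-σ * u ^ 2) : ℂ)
  have hint : Integrable (Function.uncurry f) (volume.prod m) := by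
    have hg : Integrable (fun z : ℝ × ℝ => Real.exp (-β * z.1 ^ 2) * 1) (volume.prod m) :=
      Integrable.mul_prod (integrable_exp_neg_mul_sq hβ) (integrable_const 1)
    refine hg.mono (Continuous.aestronglyMeasurable (by unfold Function.uncurry; fun_prop)) ?_
    have : ∀ᵐ z ∂(volume.prod m : Measure (ℝ × ℝ)), β ≤ z.2 :=
      Measure.quasiMeasurePreserving_snd.ae hm
    filter_upwards [this] with z hz
    simp only [Function.uncurry, f, norm_mul, Complex.norm_exp_ofReal_mul_I, Complex.norm_real,
      one_mul, Real.norm_of_nonneg (Real.exp_pos _).le, mul_one]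
    refine Real.exp_le_exp.2 ?_
    nlinarith [sq_nonneg z.1]
  have hinner : ∀ᵐ σ ∂m, ∫ u, f u σ = (r σ : ℂ) := by
    filter_upwards [hm] with σ hσ
    rw [← fourier_exp_neg_mul_sq (hβ.trans_le hσ) t, Real.fourier_real_eq_integral_exp_smul]
    rfl
  have h1 : 𝓕 (fun u => (gaussianMixture m u : ℂ)) t = ((∫ σ, r σ ∂m : ℝ) : ℂ) := by
    rw [Real.fourier_real_eq_integral_exp_smul, ← integral_complex_ofReal,
      ← integral_congr_ae hinner, ← integral_integral_swap hint]
    congr 1 with u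
    rw [gaussianMixture, ← integral_complex_ofReal, smul_eq_mul, ← integral_const_mul]
  have hr : Integrable r m := by
    have h2 := hint.integral_prod_right
    have h3 : Integrable (fun σ => (r σ : ℂ)) m := h2.congr hinner
    simpa using h3.re
  rw [h1]
  refine Complex.ofReal_ne_zero.2 (integral_pos_of_forall_pos hm0 hr ?_).ne'
  filter_upwards [hm] with σ hσ
  have := hβ.trans_le hσ
  have := Real.pi_pos
  positivity

lemma hasDerivAt_exp_neg_mul_sq (σ u : ℝ) :
    HasDerivAt (fun u => Real.exp (-σ * u ^ 2)) (-(2 * σ * u * Real.exp (-σ * u ^ 2))) u := by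
  have h := ((hasDerivAt_pow 2 u).const_mul (-σ)).exp
  convert h using 1
  simp
  ring

/-- The total variation of `exp (-σ u²)` is `2` whatever `σ` is. This uniformity justifies Fubini in
`gaussianMixture_sub` without a first moment of `m`. -/
lemma integral_abs_two_mul_exp_neg_mul_sq {σ : ℝ} (hσ : 0 < σ) :
    Integrable (fun u => 2 * σ * u * Real.exp (-σ * u ^ 2)) ∧
      ∫ u, ‖2 * σ * u * Real.exp (-σ * u ^ 2)‖ = 2 := by
  have hi : Integrable (fun u => 2 * σ * u * Real.exp (-σ * u ^ 2)) := by
    have := (integrable_mul_exp_neg_mul_sq hσ).const_mul (2 * σ)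
    simpa only [mul_assoc] using this
  refine ⟨hi, ?_⟩
  have h1 : ∫ u in Set.Ioi (0 : ℝ), 2 * σ * u * Real.exp (-σ * u ^ 2) = 1 := by
    have h := integral_Ioi_of_hasDerivAt_of_tendsto' (a := (0 : ℝ))
      (f := fun u => -Real.exp (-σ * u ^ 2)) (m := 0)
      (f' := fun u => 2 * σ * u * Real.exp (-σ * u ^ 2))
      (fun u _ => by
        have h := (hasDerivAt_exp_neg_mul_sq σ u).neg
        rw [neg_neg] at h
        exact h) hi.integrableOn (by
        rw [← neg_zero]
        refine Filter.Tendsto.neg (Real.tendsto_exp_atBot.comp ?_)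
        exact (Filter.tendsto_pow_atTop two_ne_zero).const_mul_atTop_of_neg (by linarith))
    rw [h]; simp
  have h2 : (fun u => ‖2 * σ * u * Real.exp (-σ * u ^ 2)‖) =
      fun u => (fun v => 2 * σ * v * Real.exp (-σ * v ^ 2)) |u| := by
    ext u
    simp only [norm_mul, Real.norm_eq_abs, sq_abs, abs_of_pos hσ, abs_of_pos (Real.exp_pos _)]
    norm_num
  rw [h2, integral_comp_abs (f := fun v => 2 * σ * v * Real.exp (-σ * v ^ 2)), h1]
  norm_num

/-- The derivative of a Gaussian mixture, in integrated form. -/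
lemma gaussianMixture_sub (hβ : 0 < β) (hm : ∀ᵐ σ ∂m, β ≤ σ) (u v : ℝ) :
    gaussianMixture m v - gaussianMixture m u =
      -∫ x in u..v, ∫ σ, 2 * σ * x * Real.exp (-σ * x ^ 2) ∂m := by
  rw [intervalIntegral_integral_swap, gaussianMixture, gaussianMixture,
    ← integral_sub (integrable_exp_neg_mul_sq_mixture hβ hm v)
    (integrable_exp_neg_mul_sq_mixture hβ hm u), ← integral_neg]
  · congr 1 with σ
    rw [← intervalIntegral.integral_neg]
    exact (intervalIntegral.integral_eq_sub_of_hasDerivAt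
      (fun x _ => hasDerivAt_exp_neg_mul_sq σ x)
      (Continuous.intervalIntegrable (by fun_prop) _ _)).symm
  · rw [integrable_prod_iff' (Continuous.aestronglyMeasurable (by
      unfold Function.uncurry; fun_prop))]
    constructor
    · filter_upwards [hm] with σ hσ
      exact (integral_abs_two_mul_exp_neg_mul_sq (hβ.trans_le hσ)).1.restrict
    · refine Integrable.of_bound (C := 2) ?_ ?_
      · exact (Continuous.stronglyMeasurable (by unfold Function.uncurry; fun_prop)
          ).norm.integral_prod_left.aestronglyMeasurable
      · filter_upwards [hm] with σ hσ
        have h := integral_abs_two_mul_exp_neg_mul_sq (hβ.trans_le hσ)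
        rw [Real.norm_of_nonneg (integral_nonneg fun _ => norm_nonneg _)]
        exact (setIntegral_le_integral h.1.norm
          (Filter.Eventually.of_forall fun _ => norm_nonneg _)).trans h.2.le

/-- Makes the mixing measure finite: `q < 1` handles `0`, and the denominator together with `q > 0`
handles infinity. -/
lemma integrableOn_rpow_div_add {q : ℝ} (hβ : 0 < β) (hq0 : 0 < q) (hq1 : q < 1) :
    IntegrableOn (fun s : ℝ => s ^ (-q) / (2 * (s + β))) (Set.Ioi 0) := by
  have hmeas : Measurable fun s : ℝ => s ^ (-q) / (2 * (s + β)) := by fun_prop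
  rw [← Set.Ioc_union_Ioi_eq_Ioi zero_le_one]
  refine IntegrableOn.union ?_ ?_
  · have h := (intervalIntegral.intervalIntegrable_rpow' (a := 0) (b := 1) (r := -q)
      (by linarith)).1
    refine (h.const_mul (1 / (2 * β))).mono' hmeas.aestronglyMeasurable ?_
    refine (ae_restrict_iff' measurableSet_Ioc).2 (Filter.Eventually.of_forall fun s hs => ?_)
    have hs0 : 0 < s := hs.1
    rw [Real.norm_of_nonneg (by positivity), mul_comm (1 / _), mul_one_div]
    gcongr
    linarith
  · have h := integrableOn_Ioi_rpow_of_lt (a := -q - 1) (c := 1) (by linarith) one_pos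
    refine h.mono' hmeas.aestronglyMeasurable ?_
    refine (ae_restrict_iff' measurableSet_Ioi).2 (Filter.Eventually.of_forall fun s hs => ?_)
    have hs0 : 0 < s := one_pos.trans hs
    rw [Real.norm_of_nonneg (by positivity), Real.rpow_sub_one hs0.ne']
    gcongr
    linarith

/-- Simplifies the Gamma integral `∫ s^(-p/2) exp (-x² s) ds = Γ(1 - p/2) (1/x²)^(1 - p/2)` after
multiplication by `x`. -/
lemma mul_rpow_one_div_sq {p x : ℝ} (hx : x ≠ 0) :
    x * (1 / x ^ 2) ^ (1 - p / 2) = signPow (p - 1) x := by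
  have hx' : 0 < |x| := abs_pos.2 hx
  have h1 : (1 / x ^ 2) ^ (1 - p / 2) = |x| ^ (p - 2) := by
    rw [← sq_abs, one_div, ← Real.rpow_natCast, ← Real.rpow_neg hx'.le, ← Real.rpow_mul hx'.le]
    congr 1
    push_cast
    ring
  have h2 : |x| ^ (p - 1) = |x| * |x| ^ (p - 2) := by
    rw [mul_comm, ← Real.rpow_add_one hx'.ne']
    congr 1
    ring
  rw [h1, signPow, h2, ← mul_assoc]
  congr 1
  rcases lt_or_gt_of_ne hx with h | h
  · rw [Real.sign_of_neg h, abs_of_neg h]; ring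
  · rw [Real.sign_of_pos h, abs_of_pos h]; ring

/-- For `1 ≤ p ≤ 2`, the kernel `sign x |x|^(p-1) exp (-β x²)` is minus the derivative of a mixture
of Gaussian functions. -/
lemma exists_mixing_measure {p : ℝ} (hp1 : 1 ≤ p) (hp2 : p ≤ 2) (hβ : 0 < β) :
    ∃ m : Measure ℝ, IsFiniteMeasure m ∧ (∀ᵐ σ ∂m, β ≤ σ) ∧ ∀ x,
      ∫ σ, 2 * σ * x * Real.exp (-σ * x ^ 2) ∂m = signPow (p - 1) x * Real.exp (-β * x ^ 2) := by
  rcases hp2.eq_or_lt with rfl | hp2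
  -- At `p = 2` the Gamma representation degenerates, but the kernel `x exp (-β x²)` is already
  -- minus the derivative of a single Gaussian with weight `1 / (2β)`.
  · refine ⟨(1 / (2 * β)).toNNReal • Measure.dirac β, inferInstance, ?_, fun x => ?_⟩
    · exact Measure.ae_smul_measure ((ae_dirac_iff measurableSet_Ici).2 (le_refl β)) _
    · rw [integral_smul_nnreal_measure, integral_dirac, NNReal.smul_def, smul_eq_mul,
        Real.coe_toNNReal _ (by positivity), signPow]
      have h1 : Real.sign x * |x| ^ ((2 : ℝ) - 1) = x := by
        norm_num
        rcases lt_trichotomy x 0 with h | h | h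
        · rw [Real.sign_of_neg h, abs_of_neg h]; ring
        · simp [h]
        · rw [Real.sign_of_pos h, abs_of_pos h]; ring
      rw [h1]
      field_simp
  · set Γ := Real.Gamma (1 - p / 2)
    have hΓ : 0 < Γ := Real.Gamma_pos_of_pos (by linarith)
    -- From `|x|^(p-2) = Γ⁻¹ ∫ s^(-p/2) exp (-s x²) ds`. The factor `exp (-β x²)` shifts `s` to `σ =
    -- s + β`, and dividing by `2 (s + β)` cancels the `2σ` produced by differentiation.
    let ρ : ℝ → ℝ := fun s => s ^ (-(p / 2)) / (2 * (s + β)) / Γ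
    have hρm : Measurable ρ := by fun_prop
    have hρi : IntegrableOn ρ (Set.Ioi 0) :=
      (integrableOn_rpow_div_add hβ (by linarith) (by linarith)).div_const _
    let κ : Measure ℝ := (volume.restrict (Set.Ioi 0)).withDensity fun s => ENNReal.ofReal (ρ s)
    have hκ : IsFiniteMeasure κ := isFiniteMeasure_withDensity_ofReal hρi.2
    refine ⟨κ.map (· + β), inferInstance, ?_, fun x => ?_⟩
    · rw [ae_map_iff (by fun_prop) measurableSet_Ici]
      refine (withDensity_absolutelyContinuous _ _).ae_le ?_
      refine (ae_restrict_iff' measurableSet_Ioi).2 (Filter.Eventually.of_forall fun s hs => ?_)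
      have : 0 < s := hs
      simp [this.le]
    · rw [integral_map (by fun_prop) (Continuous.aestronglyMeasurable (by fun_prop)),
        integral_withDensity_eq_integral_toReal_smul (by fun_prop)
        (Filter.Eventually.of_forall fun _ => ENNReal.ofReal_lt_top)]
      by_cases hx : x = 0
      · simp [hx, signPow]
      have h1 : ∀ s ∈ Set.Ioi (0 : ℝ), (ENNReal.ofReal (ρ s)).toReal •
          (2 * (s + β) * x * Real.exp (-(s + β) * x ^ 2)) =
          (x * Real.exp (-β * x ^ 2) / Γ) *
            (s ^ (1 - p / 2 - 1) * Real.exp (-(x ^ 2 * s))) := by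
        intro s hs
        have hs0 : 0 < s := hs
        have hsβ : 0 < s + β := by linarith
        rw [ENNReal.toReal_ofReal (by simp only [ρ]; positivity), smul_eq_mul]
        have h2 : Real.exp (-(s + β) * x ^ 2) =
            Real.exp (-β * x ^ 2) * Real.exp (-(x ^ 2 * s)) := by
          rw [← Real.exp_add]; congr 1; ring
        have h3 : 1 - p / 2 - 1 = -(p / 2) := by ring
        rw [h2, h3]
        simp only [ρ]
        field_simp
      rw [setIntegral_congr_fun measurableSet_Ioi h1, integral_const_mul,
        Real.integral_rpow_mul_exp_neg_mul_Ioi (by linarith) (by positivity),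
        ← mul_rpow_one_div_sq hx]
      change x * Real.exp (-β * x ^ 2) / Γ * ((1 / x ^ 2) ^ (1 - p / 2) * Γ) = _
      rw [mul_comm _ Γ, ← mul_assoc, div_mul_cancel₀ _ hΓ.ne']
      ring

/-- The kernel attached to the `L^p` optimality condition is, for `1 ≤ p ≤ 2`, minus the derivative
of a positive kernel whose Fourier transform does not vanish. -/
theorem exists_primitive_kernel {p β : ℝ} (hp1 : 1 ≤ p) (hp2 : p ≤ 2) (hβ : 0 < β) :
    ∃ L : ℝ → ℝ, Continuous L ∧ (∀ u, 0 < L u) ∧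
      (∀ n : ℕ, Integrable (fun u => ‖u‖ ^ n * ‖L u‖)) ∧
      (∀ t, 𝓕 (fun u => (L u : ℂ)) t ≠ 0) ∧
      (∃ A, ∀ u, L u ≤ A * Real.exp (-β * u ^ 2)) ∧
      ∀ u v, L v - L u = -∫ x in u..v, signPow (p - 1) x * Real.exp (-β * x ^ 2) := by
  obtain ⟨m, _, hm, hK⟩ := exists_mixing_measure hp1 hp2 hβ
  have hm0 : m ≠ 0 := by
    rintro rfl
    have := hK 1
    simp [signPow] at this
    exact (Real.exp_pos _).ne this
  refine ⟨gaussianMixture m, continuous_gaussianMixture hβ hm, gaussianMixture_pos hβ hm hm0,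
    integrable_pow_mul_gaussianMixture hβ hm hm0, fourier_gaussianMixture_ne_zero hβ hm hm0,
    ⟨_, gaussianMixture_le hβ hm⟩, fun u v => ?_⟩
  rw [gaussianMixture_sub hβ hm]
  simp_rw [hK]

end GaussianMixture

/-! ### First order optimality condition -/

section FirstOrder

lemma measurable_real_sign : Measurable Real.sign := by
  unfold Real.sign
  exact Measurable.ite measurableSet_Iio measurable_const
    (Measurable.ite measurableSet_Ioi measurable_const measurable_const)

lemma measurable_signPow (q : ℝ) : Measurable (signPow q) := by
  have := measurable_real_sign
  unfold signPow
  fun_prop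

lemma signPow_zero (q : ℝ) : signPow q 0 = 0 := by simp [signPow]

lemma abs_signPow_le (q u : ℝ) : |signPow q u| ≤ |u| ^ q := by
  have h : |Real.sign u| ≤ 1 := by
    rcases Real.sign_apply_eq u with h | h | h <;> simp [h]
  have h0 := Real.rpow_nonneg (abs_nonneg u) q
  rw [signPow, abs_mul, abs_of_nonneg h0]
  exact mul_le_of_le_one_left h0 h

lemma abs_rpow_add_le {p : ℝ} (hp : 1 ≤ p) {a b : ℝ} (ha : 0 ≤ a) (hb : 0 ≤ b) (hab : a + b = 1)
    (x y : ℝ) : |a * x + b * y| ^ p ≤ a * |x| ^ p + b * |y| ^ p := by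
  have h1 : |a * x + b * y| ≤ a * |x| + b * |y| := by
    refine (abs_add_le _ _).trans_eq ?_
    rw [abs_mul, abs_mul, abs_of_nonneg ha, abs_of_nonneg hb]
  refine (Real.rpow_le_rpow (abs_nonneg _) h1 (by linarith)).trans ?_
  simpa using (convexOn_rpow hp).2 (abs_nonneg x) (abs_nonneg y) ha hb hab

lemma abs_add_rpow_le {p : ℝ} (hp : 1 ≤ p) (x y : ℝ) :
    |x + y| ^ p ≤ 2 ^ p * |x| ^ p + 2 ^ p * |y| ^ p := by
  have h := abs_rpow_add_le hp (a := 1 / 2) (b := 1 / 2) (by norm_num) (by norm_num) (by norm_num)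
    (2 * x) (2 * y)
  have e : 1 / 2 * (2 * x) + 1 / 2 * (2 * y) = x + y := by ring
  have hx : 0 ≤ |x| ^ p := Real.rpow_nonneg (abs_nonneg _) _
  have hy : 0 ≤ |y| ^ p := Real.rpow_nonneg (abs_nonneg _) _
  have h2 : (0 : ℝ) ≤ 2 ^ p := Real.rpow_nonneg (by norm_num) _
  rw [e, abs_mul, abs_mul, abs_two, Real.mul_rpow zero_le_two (abs_nonneg _),
    Real.mul_rpow zero_le_two (abs_nonneg _)] at h
  nlinarith [mul_nonneg h2 hx, mul_nonneg h2 hy]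

lemma sign_mul_rpow_slope {p w : ℝ} (hw : w ≠ 0) (h : ℝ) :
    Filter.Tendsto (fun ε => ε⁻¹ * (|w - ε * h| ^ p - |w| ^ p)) (nhdsWithin 0 (Set.Ioi 0))
      (nhds (-(p * (signPow (p - 1) w * h)))) := by
  have hs : ((SignType.sign w : SignType) : ℝ) = Real.sign w := by
    rcases lt_or_gt_of_ne hw with h | h
    · simp [h, Real.sign_of_neg h]
    · simp [h, Real.sign_of_pos h]
  have h1 : HasDerivAt (fun ε : ℝ => w - ε * h) (-(1 * h)) 0 :=
    ((hasDerivAt_id (0 : ℝ)).mul_const h).const_sub w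
  have h2 : HasDerivAt (fun x : ℝ => |x| ^ p) (Real.sign w * p * |w| ^ (p - 1)) (w - 0 * h) := by
    rw [zero_mul, sub_zero, ← hs]
    exact (hasDerivAt_abs hw).rpow_const (Or.inl (abs_ne_zero.2 hw))
  have h3 := (HasDerivAt.comp (0 : ℝ) h2 h1).tendsto_slope_zero_right
  simp only [Function.comp, zero_add, zero_mul, sub_zero, smul_eq_mul] at h3
  convert h3 using 2
  rw [signPow]
  ring

/-- First order optimality condition for the `L^p` loss. -/
lemma integral_signPow_mul_le {Ω : Type*} [MeasurableSpace Ω] {μ : Measure Ω} [IsFiniteMeasure μ]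
    {p : ℝ} (hp : 1 ≤ p) {W h : Ω → ℝ} (hW : AEMeasurable W μ) (hh : AEMeasurable h μ)
    (hWi : Integrable (fun ω => |W ω| ^ p) μ) (hhi : Integrable (fun ω => |h ω| ^ p) μ)
    (hopt : ∀ ε > 0, ∫ ω, |W ω| ^ p ∂μ ≤ ∫ ω, |W ω - ε * h ω| ^ p ∂μ) :
    p * ∫ ω, signPow (p - 1) (W ω) * h ω ∂μ ≤ ∫ ω, (if W ω = 0 then |h ω| ^ p else 0) ∂μ := by
  have hshift : ∀ c : ℝ, Integrable (fun ω => |W ω - c * h ω| ^ p) μ := by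
    intro c
    refine ((hWi.const_mul (2 ^ p)).add ((hhi.const_mul (|c| ^ p)).const_mul (2 ^ p))).mono'
      (AEMeasurable.aestronglyMeasurable (by fun_prop)) ?_
    refine Filter.Eventually.of_forall fun ω => ?_
    rw [Real.norm_of_nonneg (Real.rpow_nonneg (abs_nonneg _) _)]
    have := abs_add_rpow_le hp (W ω) (-(c * h ω))
    rwa [← sub_eq_add_neg, abs_neg, abs_mul, Real.mul_rpow (abs_nonneg _) (abs_nonneg _)] at this
  -- Where `W = 0` the difference quotient is `ε^(p-1) |h|^p`; its upper bound `|h|^p` replaces it,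
  -- which treats `p = 1` and `p > 1` together.
  let D : ℝ → Ω → ℝ := fun ε ω =>
    if W ω = 0 then |h ω| ^ p else ε⁻¹ * (|W ω - ε * h ω| ^ p - |W ω| ^ p)
  let ℓ : Ω → ℝ := fun ω => if W ω = 0 then |h ω| ^ p else -(p * (signPow (p - 1) (W ω) * h ω))
  let b : Ω → ℝ := fun ω =>
    |h ω| ^ p + (|W ω - 1 * h ω| ^ p + |W ω - (-1) * h ω| ^ p + |W ω| ^ p + |W ω| ^ p)
  have hbi : Integrable b μ := hhi.add ((((hshift 1).add (hshift (-1))).add hWi).add hWi)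
  have hite : ∀ {u v : Ω → ℝ}, AEMeasurable u μ → AEMeasurable v μ →
      AEMeasurable (fun ω => if W ω = 0 then u ω else v ω) μ := by
    intro u v hu hv
    have hm : Measurable fun x : ℝ × ℝ × ℝ => if x.1 = 0 then x.2.1 else x.2.2 :=
      Measurable.ite (measurable_fst (measurableSet_singleton (0 : ℝ))) (by fun_prop) (by fun_prop)
    exact hm.comp_aemeasurable (hW.prodMk (hu.prodMk hv))
  have hDm : ∀ ε, AEStronglyMeasurable (D ε) μ := fun ε =>
    (hite (by fun_prop) (by fun_prop)).aestronglyMeasurable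
  have hnn : ∀ x : ℝ, 0 ≤ |x| ^ p := fun x => Real.rpow_nonneg (abs_nonneg _) _
  -- By convexity the quotient for `0 < ε ≤ 1` lies between the unit-step increments in the
  -- directions `h` and `-h`, giving a bound independent of `ε`.
  have hDb : ∀ ε ∈ Set.Ioc (0 : ℝ) 1, ∀ ω, ‖D ε ω‖ ≤ b ω := by
    intro ε hε ω
    have n1 := hnn (h ω)
    have n2 := hnn (W ω - 1 * h ω)
    have n3 := hnn (W ω - (-1) * h ω)
    have n4 := hnn (W ω)
    simp only [D, b]
    split_ifs with h0
    · rw [Real.norm_of_nonneg n1]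
      linarith
    · have c1 : |W ω - ε * h ω| ^ p ≤ (1 - ε) * |W ω| ^ p + ε * |W ω - 1 * h ω| ^ p := by
        have := abs_rpow_add_le hp (sub_nonneg.2 hε.2) hε.1.le (by ring) (W ω) (W ω - 1 * h ω)
        have e : (1 - ε) * W ω + ε * (W ω - 1 * h ω) = W ω - ε * h ω := by ring
        rwa [e] at this
      have hε1 : 0 < 1 + ε := by linarith [hε.1]
      have c2 : (1 + ε) * |W ω| ^ p ≤ |W ω - ε * h ω| ^ p + ε * |W ω - (-1) * h ω| ^ p := by
        have := abs_rpow_add_le hp (a := 1 / (1 + ε)) (b := ε / (1 + ε)) (by positivity)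
          (div_nonneg hε.1.le hε1.le) (by field_simp) (W ω - ε * h ω) (W ω - (-1) * h ω)
        have e : 1 / (1 + ε) * (W ω - ε * h ω) + ε / (1 + ε) * (W ω - (-1) * h ω) = W ω := by
          field_simp
          ring
        rw [e] at this
        calc (1 + ε) * |W ω| ^ p ≤ (1 + ε) * (1 / (1 + ε) * |W ω - ε * h ω| ^ p +
              ε / (1 + ε) * |W ω - (-1) * h ω| ^ p) := by gcongr
          _ = _ := by field_simp
      rw [Real.norm_eq_abs, abs_mul, abs_of_pos (inv_pos.2 hε.1), inv_mul_le_iff₀ hε.1, abs_le]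
      have hε0 := hε.1
      constructor <;> nlinarith [mul_nonneg hε0.le n1, mul_nonneg hε0.le n2,
        mul_nonneg hε0.le n3, mul_nonneg hε0.le n4]
  have hIoc : Set.Ioc (0 : ℝ) 1 ∈ nhdsWithin (0 : ℝ) (Set.Ioi 0) := Ioc_mem_nhdsGT one_pos
  have hlim : Filter.Tendsto (fun ε => ∫ ω, D ε ω ∂μ) (nhdsWithin 0 (Set.Ioi 0))
      (nhds (∫ ω, ℓ ω ∂μ)) := by
    refine tendsto_integral_filter_of_dominated_convergence b
      (Filter.Eventually.of_forall hDm) ?_ hbi ?_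
    · filter_upwards [hIoc] with ε hε
      exact Filter.Eventually.of_forall (hDb ε hε)
    · refine Filter.Eventually.of_forall fun ω => ?_
      simp only [D, ℓ]
      split_ifs with h0
      · exact tendsto_const_nhds
      · exact sign_mul_rpow_slope h0 (h ω)
  have hpos : ∀ ε ∈ Set.Ioc (0 : ℝ) 1, 0 ≤ ∫ ω, D ε ω ∂μ := by
    intro ε hε
    have hε0 := hε.1
    have h1 : 0 ≤ ∫ ω, ε⁻¹ * (|W ω - ε * h ω| ^ p - |W ω| ^ p) ∂μ := by
      rw [integral_const_mul, integral_sub (hshift ε) hWi]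
      exact mul_nonneg (inv_pos.2 hε.1).le (sub_nonneg.2 (hopt ε hε.1))
    refine h1.trans (integral_mono (((hshift ε).sub hWi).const_mul _)
      (hbi.mono' (hDm ε) (Filter.Eventually.of_forall (hDb ε hε))) fun ω => ?_)
    simp only [D]
    split_ifs with h0
    · rw [h0, abs_zero, Real.zero_rpow (by linarith), zero_sub, sub_zero, abs_neg, abs_mul,
        Real.mul_rpow (abs_nonneg _) (abs_nonneg _), abs_of_pos hε.1, ← mul_assoc]
      refine mul_le_of_le_one_left (hnn _) ?_
      rw [inv_mul_le_iff₀ hε.1, mul_one]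
      simpa using Real.rpow_le_rpow_of_exponent_ge hε.1 hε.2 hp
    · exact le_rfl
  have hℓ : 0 ≤ ∫ ω, ℓ ω ∂μ := ge_of_tendsto hlim (by filter_upwards [hIoc] with ε hε using hpos ε hε)
  have hWm := (measurable_signPow (p - 1)).comp_aemeasurable hW
  have hℓb : ∀ ω, ‖ℓ ω‖ ≤ b ω := by
    intro ω
    have ht : Filter.Tendsto (fun ε => D ε ω) (nhdsWithin 0 (Set.Ioi 0)) (nhds (ℓ ω)) := by
      simp only [D, ℓ]
      split_ifs with h0
      · exact tendsto_const_nhds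
      · exact sign_mul_rpow_slope h0 (h ω)
    exact le_of_tendsto ht.norm (by filter_upwards [hIoc] with ε hε using hDb ε hε ω)
  have hℓm : AEStronglyMeasurable ℓ μ := by
    refine (hite (by fun_prop) ?_).aestronglyMeasurable
    exact ((hWm.mul hh).const_mul p).neg
  have hℓi : Integrable ℓ μ := hbi.mono' hℓm (Filter.Eventually.of_forall hℓb)
  have hIi : Integrable (fun ω => if W ω = 0 then |h ω| ^ p else 0) μ := by
    refine hhi.mono' (hite (by fun_prop) (by fun_prop)).aestronglyMeasurable
      (Filter.Eventually.of_forall fun ω => ?_)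
    split_ifs
    · rw [Real.norm_of_nonneg (hnn _)]
    · simpa using hnn (h ω)
  have e : ∀ ω, p * (signPow (p - 1) (W ω) * h ω) =
      (if W ω = 0 then |h ω| ^ p else 0) - ℓ ω := by
    intro ω
    simp only [ℓ]
    split_ifs with h0
    · rw [h0, signPow_zero]; ring
    · ring
  rw [← integral_const_mul]
  simp_rw [e]
  rw [integral_sub hIi hℓi]
  linarith

end FirstOrder

/-! ### Localizing the condition in the observation -/

section GaussianChannel

variable {Ω : Type*} [MeasurableSpace Ω] {μ : Measure Ω} {X Z : Ω → ℝ}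

/-- The joint law of the signal and of its observation through an additive Gaussian channel. -/
lemma map_prodMk_add_eq_withDensity [IsProbabilityMeasure μ] (hX : AEMeasurable X μ) (hZ : HasLaw Z (gaussianReal 0 1) μ)
    (hXZ : IndepFun X Z μ) :
    μ.map (fun ω => (X ω, X ω + Z ω)) = ((μ.map X).prod volume).withDensity
      (fun z => gaussianPDF 0 1 (z.2 - z.1)) := by
  have hφ : Measurable fun z : ℝ × ℝ => gaussianPDF 0 1 (z.2 - z.1) :=
    (measurable_gaussianPDF 0 1).comp (by fun_prop)
  have hφ' := measurable_gaussianPDF 0 1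
  refine Measure.ext_of_lintegral _ fun f hf => ?_
  have hlaw : HasLaw (fun ω => (X ω, Z ω)) ((μ.map X).prod (gaussianReal 0 1)) μ :=
    (indepFun_iff_hasLaw_prodMk_prod ⟨hX, rfl⟩ hZ).1 hXZ
  have hg : Measurable fun z : ℝ × ℝ => f (z.1, z.1 + z.2) := by fun_prop
  have hXY : AEMeasurable (fun ω => (X ω, X ω + Z ω)) μ := hX.prodMk (hX.add hZ.aemeasurable)
  rw [lintegral_map' hf.aemeasurable hXY,
    lintegral_withDensity_eq_lintegral_mul _ hφ hf]
  have h1 := hlaw.lintegral_comp hg.aemeasurable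
  rw [h1, lintegral_prod _ hg.aemeasurable, lintegral_prod _ (hφ.mul hf).aemeasurable]
  congr 1 with x
  rw [gaussianReal_of_var_ne_zero 0 one_ne_zero,
    lintegral_withDensity_eq_lintegral_mul _ hφ' (g := fun y => f (x, x + y)) (by fun_prop)]
  refine Eq.trans ?_
    (lintegral_add_left_eq_self (fun y => gaussianPDF 0 1 (y - x) * f (x, y)) x)
  congr 1 with y
  simp

/-- Integration against the joint law of the signal and of its observation. -/
lemma integral_prodMk_add [IsProbabilityMeasure μ] (hX : AEMeasurable X μ) (hZ : HasLaw Z (gaussianReal 0 1) μ)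
    (hXZ : IndepFun X Z μ) {F : ℝ × ℝ → ℝ} (hF : Measurable F)
    (hFi : Integrable (fun ω => F (X ω, X ω + Z ω)) μ) :
    Integrable (fun y => ∫ x, gaussianPDFReal 0 1 (y - x) * F (x, y) ∂(μ.map X)) ∧
    ∫ ω, F (X ω, X ω + Z ω) ∂μ =
      ∫ y, ∫ x, gaussianPDFReal 0 1 (y - x) * F (x, y) ∂(μ.map X) := by
  have hφ : Measurable fun z : ℝ × ℝ => gaussianPDF 0 1 (z.2 - z.1) :=
    (measurable_gaussianPDF 0 1).comp (by fun_prop)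
  have hlt : ∀ᵐ z ∂((μ.map X).prod volume), gaussianPDF 0 1 (z.2 - z.1) < ⊤ :=
    Filter.Eventually.of_forall fun _ => gaussianPDF_lt_top
  have hprob := Measure.isProbabilityMeasure_map hX
  have hXY : AEMeasurable (fun ω => (X ω, X ω + Z ω)) μ := hX.prodMk (hX.add hZ.aemeasurable)
  have h1 : Integrable F (μ.map (fun ω => (X ω, X ω + Z ω))) :=
    (integrable_map_measure hF.aestronglyMeasurable hXY).2 hFi
  have h2 : Integrable (fun z : ℝ × ℝ => gaussianPDFReal 0 1 (z.2 - z.1) * F z)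
      ((μ.map X).prod volume) := by
    rw [map_prodMk_add_eq_withDensity hX hZ hXZ,
      integrable_withDensity_iff_integrable_smul' hφ hlt] at h1
    simpa only [toReal_gaussianPDF, smul_eq_mul] using h1
  refine ⟨h2.integral_prod_right, ?_⟩
  rw [← integral_prod_symm _ h2, ← integral_map hXY hF.aestronglyMeasurable,
    map_prodMk_add_eq_withDensity hX hZ hXZ, integral_withDensity_eq_integral_toReal_smul hφ hlt]
  simp only [toReal_gaussianPDF, smul_eq_mul]

/-- The estimator `y` has error `-Z`, whose moments are finite. An optimal risk is therefore finite
with no moment assumption on `X`. -/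
lemma bayesRisk_observation_lt_top {p : ℝ} (hp1 : 1 ≤ p) (hZ : HasLaw Z (gaussianReal 0 1) μ) :
    _root_.bayesRisk μ p X (X + Z) id < ⊤ := by
  have h1 : _root_.bayesRisk μ p X (X + Z) id = ∫⁻ z, ENNReal.ofReal (|z| ^ p) ∂(gaussianReal 0 1) := by
    rw [← hZ.lintegral_comp (by fun_prop), _root_.bayesRisk]
    congr 1 with ω
    simp [abs_neg]
  have h2 := (memLp_id_gaussianReal (μ := 0) (v := 1) p.toNNReal).integrable_norm_rpow
    (by simp; linarith) (by simp)
  rw [h1]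
  simp only [ENNReal.coe_toReal, id, Real.norm_eq_abs, Real.coe_toNNReal _ (by linarith : 0 ≤ p)]
    at h2
  exact h2.lintegral_lt_top

lemma integrable_abs_rpow_of_isOptimal {p a : ℝ} (hp1 : 1 ≤ p) (hX : AEMeasurable X μ)
    (hZ : HasLaw Z (gaussianReal 0 1) μ)
    (h : IsOptimalEstimator μ p X (X + Z) (fun y => a * y)) :
    Integrable (fun ω => |X ω - a * (X ω + Z ω)| ^ p) μ := by
  have hZm := hZ.aemeasurable
  refine ⟨AEMeasurable.aestronglyMeasurable (by fun_prop), ?_⟩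
  rw [hasFiniteIntegral_iff_ofReal
    (Filter.Eventually.of_forall fun ω => Real.rpow_nonneg (abs_nonneg _) _)]
  exact (h.2 id measurable_id).trans_lt (bayesRisk_observation_lt_top hp1 hZ)

/-- Pointwise first order condition for the optimality of a linear estimator. -/
theorem abs_integral_signPow_mul_gaussianPDFReal_le [IsProbabilityMeasure μ] {p a : ℝ} (hp1 : 1 ≤ p)
    (hX : AEMeasurable X μ) (hZ : HasLaw Z (gaussianReal 0 1) μ) (hXZ : IndepFun X Z μ)
    (h : IsOptimalEstimator μ p X (X + Z) (fun y => a * y)) :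
    ∀ᵐ y, |∫ x, gaussianPDFReal 0 1 (y - x) * signPow (p - 1) (x - a * y) ∂(μ.map X)| ≤
      gaussianPDFReal 0 1 (y - a * y) * (μ.map X).real {a * y} := by
  have hZm := hZ.aemeasurable
  have hWi := integrable_abs_rpow_of_isOptimal hp1 hX hZ h
  have hs := measurable_signPow (p - 1)
  set W : Ω → ℝ := fun ω => X ω - a * (X ω + Z ω) with hWdef
  have hW : AEMeasurable W μ := by fun_prop
  have hsi : Integrable (fun ω => signPow (p - 1) (W ω)) μ := by
    refine ((integrable_const (1 : ℝ)).add hWi).mono'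
      (hs.comp_aemeasurable hW).aestronglyMeasurable (Filter.Eventually.of_forall fun ω => ?_)
    refine (abs_signPow_le _ _).trans ?_
    simp only [Pi.add_apply]
    rcases le_total |W ω| 1 with h1 | h1
    · have h2 := Real.rpow_le_one (abs_nonneg _) h1 (by linarith : 0 ≤ p - 1)
      have := Real.rpow_nonneg (abs_nonneg (W ω)) p
      linarith
    · have := Real.rpow_le_rpow_of_exponent_le h1 (by linarith : p - 1 ≤ p)
      linarith
  -- Indicator of a vanishing error; its integral against the law of `X` gives the atom at `a * y`.
  let I : ℝ × ℝ → ℝ := fun z => if z.1 - a * z.2 = 0 then 1 else 0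
  have hI : Measurable I :=
    Measurable.ite ((by fun_prop : Measurable fun z : ℝ × ℝ => z.1 - a * z.2)
      (measurableSet_singleton (0 : ℝ))) measurable_const measurable_const
  have hI1 : ∀ z, ‖I z‖ ≤ 1 := fun z => by simp only [I]; split_ifs <;> simp
  -- testing against a sign and a measurable set
  have key : ∀ s : ℝ, |s| = 1 → ∀ B : Set ℝ, MeasurableSet B →
      ∫ y in B, s * ∫ x, gaussianPDFReal 0 1 (y - x) * signPow (p - 1) (x - a * y) ∂(μ.map X) ≤
      ∫ y in B, ∫ x, gaussianPDFReal 0 1 (y - x) * I (x, y) ∂(μ.map X) := by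
    intro s hs1 B hB
    let k : ℝ → ℝ := B.indicator fun _ => s
    have hk : Measurable k := measurable_const.indicator hB
    have hk1 : ∀ y, |k y| ^ p = B.indicator (fun _ => 1) y := fun y => by
      by_cases hy : y ∈ B
      · simp [k, hy, hs1]
      · simp [k, hy, Real.zero_rpow (by linarith : p ≠ 0)]
    have hkle : ∀ y, ‖k y‖ ≤ 1 := fun y => by
      by_cases hy : y ∈ B
      · simp [k, hy, hs1]
      · simp [k, hy]
    have hYm : AEMeasurable (fun ω => X ω + Z ω) μ := hX.add hZm
    have hkY : AEMeasurable (fun ω => k (X ω + Z ω)) μ := hk.comp_aemeasurable hYm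
    have hki : Integrable (fun ω => |k (X ω + Z ω)| ^ p) μ := by
      refine Integrable.of_bound (AEMeasurable.aestronglyMeasurable (by fun_prop)) 1
        (Filter.Eventually.of_forall fun ω => ?_)
      rw [hk1]
      by_cases hy : X ω + Z ω ∈ B <;> simp [hy]
    have hopt : ∀ ε > 0, ∫ ω, |W ω| ^ p ∂μ ≤ ∫ ω, |W ω - ε * k (X ω + Z ω)| ^ p ∂μ := by
      intro ε _
      have hnn : ∀ f : Ω → ℝ, 0 ≤ᵐ[μ] fun ω => |f ω| ^ p := fun f =>
        Filter.Eventually.of_forall fun ω => Real.rpow_nonneg (abs_nonneg _) _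
      have hεi : Integrable (fun ω => |W ω - ε * k (X ω + Z ω)| ^ p) μ := by
        refine ((hWi.const_mul (2 ^ p)).add
          ((hki.const_mul (|ε| ^ p)).const_mul (2 ^ p))).mono'
          (AEMeasurable.aestronglyMeasurable (by fun_prop))
          (Filter.Eventually.of_forall fun ω => ?_)
        rw [Real.norm_of_nonneg (Real.rpow_nonneg (abs_nonneg _) _)]
        have := abs_add_rpow_le hp1 (W ω) (-(ε * k (X ω + Z ω)))
        rwa [← sub_eq_add_neg, abs_neg, abs_mul, Real.mul_rpow (abs_nonneg _) (abs_nonneg _)]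
          at this
      rw [integral_eq_lintegral_of_nonneg_ae (hnn _) hWi.aestronglyMeasurable,
        integral_eq_lintegral_of_nonneg_ae (hnn _) hεi.aestronglyMeasurable]
      refine ENNReal.toReal_mono hεi.lintegral_lt_top.ne ?_
      have := h.2 (fun y => a * y + ε * k y) (by fun_prop)
      refine this.trans_eq ?_
      unfold _root_.bayesRisk
      congr 1 with ω
      simp only [Pi.add_apply, W, sub_sub]
    have h1 := integral_signPow_mul_le hp1 hW hkY hWi hki hopt
    have h2 : ∫ ω, signPow (p - 1) (W ω) * k (X ω + Z ω) ∂μ =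
        ∫ y in B, s * ∫ x, gaussianPDFReal 0 1 (y - x) * signPow (p - 1) (x - a * y)
          ∂(μ.map X) := by
      have h3 := (integral_prodMk_add hX hZ hXZ
        (F := fun z => signPow (p - 1) (z.1 - a * z.2) * k z.2) (by fun_prop)
        (hsi.mul_bdd (c := 1) hkY.aestronglyMeasurable
          (Filter.Eventually.of_forall fun ω => hkle _))).2
      rw [← integral_indicator hB]
      refine h3.trans ?_
      congr 1 with y
      by_cases hy : y ∈ B
      · simp only [k, Set.indicator_of_mem hy]
        rw [← integral_const_mul]
        congr 1 with x
        ring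
      · simp [k, hy]
    have h4 : ∫ ω, (if W ω = 0 then |k (X ω + Z ω)| ^ p else 0) ∂μ =
        ∫ y in B, ∫ x, gaussianPDFReal 0 1 (y - x) * I (x, y) ∂(μ.map X) := by
      have h3 := (integral_prodMk_add hX hZ hXZ (F := fun z => I z * |k z.2| ^ p)
        (by fun_prop) (by
          refine hki.bdd_mul (c := 1) ?_ (Filter.Eventually.of_forall fun ω => hI1 _)
          exact (hI.comp_aemeasurable (hX.prodMk hYm)).aestronglyMeasurable)).2
      have e : ∀ ω, (if W ω = 0 then |k (X ω + Z ω)| ^ p else 0) =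
          I (X ω, X ω + Z ω) * |k (X ω + Z ω)| ^ p := fun ω => by
        simp only [I, W]
        split_ifs <;> simp
      simp_rw [e]
      rw [← integral_indicator hB]
      refine h3.trans ?_
      congr 1 with y
      by_cases hy : y ∈ B
      · simp [hk1, hy]
      · simp [hk1, hy]
    rw [h2, h4] at h1
    -- With a nonnegative right-hand side, the factor `p ≥ 1` on the left can be dropped.
    have h5 : 0 ≤ ∫ y in B, ∫ x, gaussianPDFReal 0 1 (y - x) * I (x, y) ∂(μ.map X) := by
      refine integral_nonneg fun y => integral_nonneg fun x => ?_
      refine mul_nonneg (gaussianPDFReal_nonneg _ _ _) ?_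
      simp only [I]
      split_ifs <;> norm_num
    by_contra! h6
    nlinarith
  have hAi := (integral_prodMk_add hX hZ hXZ
    (F := fun z => signPow (p - 1) (z.1 - a * z.2)) (by fun_prop) hsi).1
  have hRi := (integral_prodMk_add hX hZ hXZ (F := I) hI (by
    refine Integrable.of_bound ?_ 1 (Filter.Eventually.of_forall fun ω => hI1 _)
    exact (hI.comp_aemeasurable (hX.prodMk (hX.add hZm))).aestronglyMeasurable)).1
  have hae : ∀ s : ℝ, |s| = 1 → ∀ᵐ y,
      s * ∫ x, gaussianPDFReal 0 1 (y - x) * signPow (p - 1) (x - a * y) ∂(μ.map X) ≤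
      ∫ x, gaussianPDFReal 0 1 (y - x) * I (x, y) ∂(μ.map X) := fun s hs1 =>
    ae_le_of_forall_setIntegral_le (hAi.const_mul s) hRi fun B hB _ => key s hs1 B hB
  filter_upwards [hae 1 (by simp), hae (-1) (by simp)] with y h1 h2
  have e : ∫ x, gaussianPDFReal 0 1 (y - x) * I (x, y) ∂(μ.map X) =
      gaussianPDFReal 0 1 (y - a * y) * (μ.map X).real {a * y} := by
    have : (fun x => gaussianPDFReal 0 1 (y - x) * I (x, y)) =
        ({a * y} : Set ℝ).indicator fun _ => gaussianPDFReal 0 1 (y - a * y) := by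
      ext x
      by_cases hx : x = a * y
      · simp [I, hx]
      · simp [I, hx, sub_eq_zero]
    rw [this, integral_indicator_const _ (measurableSet_singleton _), smul_eq_mul, mul_comm]
  rw [e] at h1 h2
  exact abs_le.2 ⟨by linarith, by linarith⟩

end GaussianChannel

/-! ### Slopes `a ≤ 0` -/

section NonpositiveSlope

/-- A crude bound, chosen so that Gaussian factors absorb it by completing a square. -/
lemma abs_rpow_le_exp {p : ℝ} (hp1 : 1 ≤ p) (hp2 : p ≤ 2) (x : ℝ) :
    |x| ^ (p - 1) ≤ Real.exp |x| := by
  have h1 := Real.add_one_le_exp |x|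
  have h2 : |x| ^ (p - 1) ≤ |x| + 1 := by
    rcases le_total |x| 1 with h | h
    · have := Real.rpow_le_one (abs_nonneg x) h (by linarith : 0 ≤ p - 1)
      have := abs_nonneg x
      linarith
    · have := Real.rpow_le_rpow_of_exponent_le h (by linarith : p - 1 ≤ 1)
      rw [Real.rpow_one] at this
      linarith
  linarith

lemma gaussianPDFReal_zero_one (x : ℝ) :
    gaussianPDFReal 0 1 x = (Real.sqrt (2 * Real.pi))⁻¹ * Real.exp (-(x ^ 2 / 2)) := by
  rw [gaussianPDFReal, NNReal.coe_one, sub_zero, mul_one, mul_one, neg_div]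

lemma signPow_neg (q x : ℝ) : signPow q (-x) = -signPow q x := by
  rw [signPow, signPow, Real.sign_neg, abs_neg, neg_mul]

/-- If the tilted moments of a probability measure are bounded above, then it gives no mass to the
positive half-line. -/
lemma measure_Ioi_eq_zero_of_tilted_le {p : ℝ} (hp1 : 1 ≤ p) (hp2 : p ≤ 2) {P : Measure ℝ}
    [IsProbabilityMeasure P]
    (h : ∀ᵐ y, ∫ x, signPow (p - 1) x * Real.exp (x * y - x ^ 2 / 2) ∂P ≤ 1) :
    P (Set.Ioi 0) = 0 := by
  have hs := measurable_signPow (p - 1)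
  have hint : ∀ y, Integrable (fun x => signPow (p - 1) x * Real.exp (x * y - x ^ 2 / 2)) P := by
    intro y
    refine Integrable.of_bound (Measurable.aestronglyMeasurable (by fun_prop))
      (Real.exp ((1 + |y|) ^ 2 / 2)) (Filter.Eventually.of_forall fun x => ?_)
    rw [norm_mul, Real.norm_of_nonneg (Real.exp_pos _).le, Real.norm_eq_abs]
    calc _ ≤ Real.exp |x| * Real.exp (x * y - x ^ 2 / 2) := by
          gcongr
          exact (abs_signPow_le _ _).trans (abs_rpow_le_exp hp1 hp2 x)
      _ = Real.exp (|x| + (x * y - x ^ 2 / 2)) := (Real.exp_add _ _).symm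
      _ ≤ _ := by
          refine Real.exp_le_exp.2 ?_
          have h1 : x * y ≤ |x| * |y| := by rw [← abs_mul]; exact le_abs_self _
          have h2 : x ^ 2 = |x| ^ 2 := (sq_abs x).symm
          nlinarith [sq_nonneg (|x| - (1 + |y|))]
  -- Mass on `[δ, M]` makes the tilted moment grow like `exp (δ y)`, while for `y ≥ 0` negative `x`
  -- contribute at least `-exp (1 / 2)`, as `-x - x² / 2 ≤ 1 / 2`.
  have hIcc : ∀ δ M : ℝ, 0 < δ → P (Set.Icc δ M) = 0 := by
    intro δ M hδ
    by_contra hne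
    have hr : 0 < P.real (Set.Icc δ M) := ENNReal.toReal_pos hne (measure_ne_top _ _)
    set c := δ ^ (p - 1) * Real.exp (-(M ^ 2 / 2))
    have hc : 0 < c := by positivity
    have hlow : ∀ y, 0 ≤ y → P.real (Set.Icc δ M) * (c * Real.exp (δ * y)) - Real.exp (1 / 2) ≤
        ∫ x, signPow (p - 1) x * Real.exp (x * y - x ^ 2 / 2) ∂P := by
      intro y hy
      have e : P.real (Set.Icc δ M) * (c * Real.exp (δ * y)) - Real.exp (1 / 2) =
          ∫ x, ((Set.Icc δ M).indicator (fun _ => c * Real.exp (δ * y)) x - Real.exp (1 / 2)) ∂P := by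
        rw [integral_sub ((integrable_const _).indicator measurableSet_Icc) (integrable_const _),
          integral_indicator_const _ measurableSet_Icc]
        simp
      rw [e]
      refine integral_mono (((integrable_const _).indicator measurableSet_Icc).sub
        (integrable_const _)) (hint y) fun x => ?_
      have hexp := Real.exp_pos (1 / 2)
      by_cases hx : x ∈ Set.Icc δ M
      · have hx0 : 0 < x := hδ.trans_le hx.1
        simp only [Set.indicator_of_mem hx, signPow, Real.sign_of_pos hx0, abs_of_pos hx0, one_mul]
        have h1 : δ ^ (p - 1) ≤ x ^ (p - 1) :=
          Real.rpow_le_rpow hδ.le hx.1 (by linarith)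
        have h2 : Real.exp (-(M ^ 2 / 2)) * Real.exp (δ * y) ≤ Real.exp (x * y - x ^ 2 / 2) := by
          rw [← Real.exp_add]
          refine Real.exp_le_exp.2 ?_
          have := hx.1
          have := hx.2
          nlinarith
        have h3 := mul_le_mul h1 h2 (by positivity) (by positivity)
        simp only [c]
        linarith
      · simp only [Set.indicator_of_notMem hx, zero_sub]
        rcases le_or_gt 0 x with hx0 | hx0
        · have : 0 ≤ signPow (p - 1) x := by
            rcases hx0.eq_or_lt with rfl | hx0
            · simp [signPow_zero]
            · rw [signPow, Real.sign_of_pos hx0]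
              positivity
          have := mul_nonneg this (Real.exp_pos (x * y - x ^ 2 / 2)).le
          linarith
        · have h1 : |signPow (p - 1) x * Real.exp (x * y - x ^ 2 / 2)| ≤ Real.exp (1 / 2) := by
            rw [abs_mul, abs_of_pos (Real.exp_pos _)]
            calc _ ≤ Real.exp |x| * Real.exp (x * y - x ^ 2 / 2) := by
                  gcongr
                  exact (abs_signPow_le _ _).trans (abs_rpow_le_exp hp1 hp2 x)
              _ = Real.exp (|x| + (x * y - x ^ 2 / 2)) := (Real.exp_add _ _).symm
              _ ≤ _ := by
                  refine Real.exp_le_exp.2 ?_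
                  rw [abs_of_neg hx0]
                  nlinarith [sq_nonneg (x + 1), mul_nonneg (neg_nonneg.2 hx0.le) hy]
          exact (abs_le.1 h1).1
    have htend : Filter.Tendsto (fun y => P.real (Set.Icc δ M) * (c * Real.exp (δ * y)) -
        Real.exp (1 / 2)) Filter.atTop Filter.atTop := by
      refine Filter.tendsto_atTop_add_const_right _ _ ?_
      refine Filter.Tendsto.const_mul_atTop hr (Filter.Tendsto.const_mul_atTop hc ?_)
      exact Real.tendsto_exp_atTop.comp (Filter.tendsto_id.const_mul_atTop hδ)
    obtain ⟨y₀, hy₀⟩ := ((htend.eventually_gt_atTop 1).and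
      (Filter.eventually_ge_atTop 0)).exists_forall_of_atTop
    -- The hypothesis holds only almost everywhere, so the contradiction needs failure on a whole
    -- half-line.
    have hvol : volume (Set.Ici y₀) = 0 := by
      refine measure_mono_null (fun y hy => ?_) (ae_iff.1 h)
      have h1 := hy₀ y hy
      exact not_le.2 (h1.1.trans_le (hlow y h1.2))
    simp at hvol
  have hU : Set.Ioi (0 : ℝ) ⊆ ⋃ n : ℕ, Set.Icc (1 / ((n : ℝ) + 1)) n := by
    intro x hx
    have hx0 : (0 : ℝ) < x := hx
    obtain ⟨n, hn⟩ := exists_nat_ge (max x (1 / x))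
    refine Set.mem_iUnion.2 ⟨n, ?_, (le_max_left _ _).trans hn⟩
    have h1 := (le_max_right _ _).trans hn
    rw [div_le_iff₀ hx0] at h1
    rw [div_le_iff₀ (by positivity)]
    nlinarith
  exact measure_mono_null hU (measure_iUnion_null fun n => hIcc _ _ (by positivity))

variable {Ω : Type*} [MeasurableSpace Ω] {μ : Measure Ω} [IsProbabilityMeasure μ] {X Z : Ω → ℝ}

/-- If the zero estimator is optimal then the signal vanishes. -/
lemma ae_eq_zero_of_isOptimal_zero {p : ℝ} (hp1 : 1 ≤ p) (hp2 : p ≤ 2)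
    (hX : AEMeasurable X μ) (hZ : HasLaw Z (gaussianReal 0 1) μ) (hXZ : IndepFun X Z μ)
    (h : IsOptimalEstimator μ p X (X + Z) (fun y => 0 * y)) : X =ᵐ[μ] fun _ => 0 := by
  have hprob := Measure.isProbabilityMeasure_map hX
  have hs := measurable_signPow (p - 1)
  have hfoc : ∀ᵐ y, |∫ x, signPow (p - 1) x * Real.exp (x * y - x ^ 2 / 2) ∂(μ.map X)| ≤ 1 := by
    filter_upwards [abs_integral_signPow_mul_gaussianPDFReal_le hp1 hX hZ hXZ h] with y hy
    have hφ : 0 < gaussianPDFReal 0 1 y := gaussianPDFReal_pos _ _ _ one_ne_zero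
    -- Dividing the condition by `φ(y)` leaves a tilted moment. At slope `0` the atom term is the
    -- fixed mass of `{0}` and cannot be discarded; it is bounded by `1`.
    have e : ∀ x, gaussianPDFReal 0 1 (y - x) * signPow (p - 1) (x - 0 * y) =
        gaussianPDFReal 0 1 y * (signPow (p - 1) x * Real.exp (x * y - x ^ 2 / 2)) := by
      intro x
      have e1 : gaussianPDFReal 0 1 (y - x) =
          gaussianPDFReal 0 1 y * Real.exp (x * y - x ^ 2 / 2) := by
        rw [gaussianPDFReal_zero_one, gaussianPDFReal_zero_one, mul_assoc, ← Real.exp_add]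
        congr 2
        ring
      rw [e1, zero_mul, sub_zero]
      ring
    simp_rw [e] at hy
    rw [integral_const_mul, abs_mul, abs_of_pos hφ, zero_mul, sub_zero] at hy
    exact (le_of_mul_le_mul_left hy hφ).trans measureReal_le_one
  have hpos : (μ.map X) (Set.Ioi 0) = 0 :=
    measure_Ioi_eq_zero_of_tilted_le hp1 hp2 (hfoc.mono fun y hy => (abs_le.1 hy).2)
  have hneg : ((μ.map X).map (fun x => -x)) (Set.Ioi 0) = 0 := by
    have := Measure.isProbabilityMeasure_map (μ := μ.map X) (f := fun x => -x) (by fun_prop)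
    refine measure_Ioi_eq_zero_of_tilted_le hp1 hp2 ?_
    have hfoc' := (Measure.measurePreserving_neg (volume : Measure ℝ)).quasiMeasurePreserving.ae hfoc
    filter_upwards [hfoc'] with y hy
    rw [integral_map (by fun_prop) (Measurable.aestronglyMeasurable (by fun_prop))]
    have e : ∀ x, signPow (p - 1) (-x) * Real.exp (-x * y - (-x) ^ 2 / 2) =
        -(signPow (p - 1) x * Real.exp (x * -y - x ^ 2 / 2)) := fun x => by
      rw [signPow_neg, neg_mul]
      congr 3
      ring
    simp_rw [e]
    rw [integral_neg]
    linarith [(abs_le.1 hy).1]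
  rw [Measure.map_apply (by fun_prop) measurableSet_Ioi] at hneg
  have h0 : ∀ᵐ x ∂(μ.map X), x = 0 := by
    rw [ae_iff]
    refine measure_mono_null (fun x hx => ?_) (measure_union_null hpos hneg)
    rcases lt_or_gt_of_ne (show x ≠ 0 from hx) with h | h
    · exact Or.inr (by simpa using h)
    · exact Or.inl h
  exact ae_of_ae_map hX h0

/-- A linear estimator with negative slope is never optimal. -/
lemma nonneg_of_isOptimal {p a : ℝ} (hp1 : 1 ≤ p)
    (hX : AEMeasurable X μ) (hZ : HasLaw Z (gaussianReal 0 1) μ) (hXZ : IndepFun X Z μ)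
    (h : IsOptimalEstimator μ p X (X + Z) (fun y => a * y)) : 0 ≤ a := by
  by_contra! ha
  have hZm := hZ.aemeasurable
  have hWi := integrable_abs_rpow_of_isOptimal hp1 hX hZ h
  have hlaw : HasLaw (fun ω => (X ω, Z ω)) ((μ.map X).prod (gaussianReal 0 1)) μ :=
    (indepFun_iff_hasLaw_prodMk_prod ⟨hX, rfl⟩ hZ).1 hXZ
  have hnZ : HasLaw (fun ω => -Z ω) (gaussianReal 0 1) μ := by
    have := gaussianReal_neg hZ
    rw [neg_zero] at this
    exact this
  have hlaw' : HasLaw (fun ω => (X ω, -Z ω)) ((μ.map X).prod (gaussianReal 0 1)) μ :=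
    (indepFun_iff_hasLaw_prodMk_prod ⟨hX, rfl⟩ hnZ).1
      (hXZ.comp measurable_id measurable_neg)
  let f : ℝ × ℝ → ℝ≥0∞ := fun z => ENNReal.ofReal (|z.1 - a * (z.1 + z.2)| ^ p)
  have hf : Measurable f := by fun_prop
  have hsym : ∫⁻ ω, f (X ω, -Z ω) ∂μ = ∫⁻ ω, f (X ω, Z ω) ∂μ := by
    rw [hlaw'.lintegral_comp hf.aemeasurable, hlaw.lintegral_comp hf.aemeasurable]
  set I := ∫⁻ ω, ENNReal.ofReal (|X ω| ^ p) ∂μ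
  have hfin : ∫⁻ ω, f (X ω, Z ω) ∂μ < ⊤ := hWi.lintegral_lt_top
  have hle : ∫⁻ ω, f (X ω, Z ω) ∂μ ≤ I := by
    have := h.2 (fun _ => 0) measurable_const
    simpa [_root_.bayesRisk, f, I] using this
  -- The errors for `Z` and `-Z` average to `(1 - a) X`, and the two risks coincide by symmetry;
  -- convexity does the rest.
  have hmul : ENNReal.ofReal ((1 - a) ^ p) * I ≤ ∫⁻ ω, f (X ω, Z ω) ∂μ := by
    have h1 : ENNReal.ofReal ((1 - a) ^ p) * I =
        ∫⁻ ω, ENNReal.ofReal ((1 - a) ^ p * |X ω| ^ p) ∂μ := by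
      rw [← lintegral_const_mul' _ _ ENNReal.ofReal_ne_top]
      congr 1 with ω
      rw [← ENNReal.ofReal_mul (Real.rpow_nonneg (by linarith) _)]
    have h2 : ∫⁻ ω, f (X ω, Z ω) ∂μ =
        ∫⁻ ω, (ENNReal.ofReal (1 / 2) * f (X ω, Z ω) + ENNReal.ofReal (1 / 2) * f (X ω, -Z ω)) ∂μ := by
      rw [lintegral_add_left' (by fun_prop), lintegral_const_mul' _ _ ENNReal.ofReal_ne_top,
        lintegral_const_mul' _ _ ENNReal.ofReal_ne_top, hsym, ← add_mul,
        ← ENNReal.ofReal_add (by norm_num) (by norm_num)]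
      norm_num
    rw [h1, h2]
    refine lintegral_mono fun ω => ?_
    simp only [f]
    have hnn : ∀ x : ℝ, 0 ≤ |x| ^ p := fun x => Real.rpow_nonneg (abs_nonneg _) _
    rw [← ENNReal.ofReal_mul (by norm_num), ← ENNReal.ofReal_mul (by norm_num),
      ← ENNReal.ofReal_add (mul_nonneg (by norm_num) (hnn _)) (mul_nonneg (by norm_num) (hnn _))]
    refine ENNReal.ofReal_le_ofReal ?_
    have h3 := abs_rpow_add_le hp1 (a := 1 / 2) (b := 1 / 2) (by norm_num) (by norm_num)
      (by norm_num) (X ω - a * (X ω + Z ω)) (X ω - a * (X ω + -Z ω))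
    have e : 1 / 2 * (X ω - a * (X ω + Z ω)) + 1 / 2 * (X ω - a * (X ω + -Z ω)) =
        (1 - a) * X ω := by ring
    rwa [e, abs_mul, abs_of_pos (by linarith : 0 < 1 - a),
      Real.mul_rpow (by linarith) (abs_nonneg _)] at h3
  have hgt : 1 < (1 - a) ^ p := Real.one_lt_rpow (by linarith) (by linarith)
  have hIfin : I < ⊤ := by
    refine lt_of_le_of_lt ?_ (hmul.trans_lt hfin)
    exact le_mul_of_one_le_left' (by simpa using ENNReal.ofReal_le_ofReal hgt.le)
  -- `(1 - a)^p I ≤ I` with `(1 - a)^p > 1` and `I` finite. Then `X` and the optimal error vanish,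
  -- hence so does `Z`, which is absurd.
  have hI0 : I = 0 := by
    by_contra hne
    have : 1 * I < ENNReal.ofReal ((1 - a) ^ p) * I := by
      refine (ENNReal.mul_lt_mul_iff_left hne hIfin.ne).2 ?_
      simpa using hgt
    rw [one_mul] at this
    exact absurd (this.trans_le (hmul.trans hle)) (lt_irrefl _)
  have hz : ∀ {u : Ω → ℝ}, AEMeasurable u μ → ∫⁻ ω, ENNReal.ofReal (|u ω| ^ p) ∂μ = 0 →
      ∀ᵐ ω ∂μ, u ω = 0 := by
    intro u hu h0
    rw [lintegral_eq_zero_iff' (by fun_prop)] at h0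
    filter_upwards [h0] with ω hω
    by_contra hne
    have : 0 < |u ω| ^ p := Real.rpow_pos_of_pos (abs_pos.2 hne) _
    simp only [Pi.zero_apply, ENNReal.ofReal_eq_zero] at hω
    linarith
  have hX0 := hz hX hI0
  have hW0 := hz (u := fun ω => X ω - a * (X ω + Z ω)) (by fun_prop)
    (le_antisymm (hle.trans hI0.le) zero_le)
  have hZ0 : ∀ᵐ ω ∂μ, Z ω = 0 := by
    filter_upwards [hX0, hW0] with ω h1 h2
    rw [h1] at h2
    have : a * Z ω = 0 := by linarith
    exact (mul_eq_zero.1 this).resolve_left ha.ne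
  have h0 : ∀ᵐ z ∂(gaussianReal 0 1), z = 0 := (hZ.ae_iff (by fun_prop)).1 hZ0
  have hatoms : NullSingletonClass (gaussianReal 0 1) := nullSingletonClass_gaussianReal one_ne_zero
  have h1 : ∀ᵐ z ∂(gaussianReal 0 1), z ≠ 0 := by
    rw [ae_iff]
    simp
  obtain ⟨z, hz0, hz1⟩ := (h0.and h1).exists
  exact hz1 hz0

end NonpositiveSlope

/-! ### Slopes `a > 0` -/

section PositiveSlope

/-- `P` has countably many atoms, and their preimage under an injective map is countable, hence
Lebesgue null. -/
lemma ae_measure_singleton_mul_eq_zero {P : Measure ℝ} [SFinite P] {a : ℝ} (ha : a ≠ 0) :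
    ∀ᵐ y : ℝ, P {a * y} = 0 := by
  have hc : Set.Countable {t : ℝ | 0 < P {x : ℝ | id x = t}} :=
    Measure.countable_meas_level_set_pos measurable_id
  have hc' : Set.Countable ((fun y => a * y) ⁻¹' {t : ℝ | 0 < P {x : ℝ | id x = t}}) :=
    hc.preimage (mul_right_injective₀ ha)
  rw [ae_iff]
  refine measure_mono_null (fun y hy => ?_) (hc'.measure_zero volume)
  exact pos_iff_ne_zero.2 hy

/-- A probability measure with density proportional to `exp (-b x² / 2)` is a centered Gaussian. -/
lemma eq_gaussianReal_of_withDensity {P : Measure ℝ} [IsProbabilityMeasure P] {b : ℝ} {c : ℝ≥0}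
    (h : P = (c • (volume : Measure ℝ)).withDensity
      fun x => ENNReal.ofReal (Real.exp (-(b * x ^ 2 / 2)))) :
    0 < b ∧ P = gaussianReal 0 (Real.toNNReal (1 / b)) := by
  have hm : Measurable fun x : ℝ => ENNReal.ofReal (Real.exp (-(b * x ^ 2 / 2))) := by fun_prop
  have huniv : 1 = (c : ℝ≥0∞) * ∫⁻ x, ENNReal.ofReal (Real.exp (-(b * x ^ 2 / 2))) := by
    have h1 := congrArg (fun m : Measure ℝ => m Set.univ) h
    simp only [measure_univ, withDensity_apply _ MeasurableSet.univ, Measure.restrict_univ] at h1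
    rw [h1, lintegral_smul_measure]
    rfl
  -- For `b ≤ 0` the exponential is at least `1`, so its integral is infinite.
  have hb : 0 < b := by
    by_contra! hb
    have htop : ∫⁻ x, ENNReal.ofReal (Real.exp (-(b * x ^ 2 / 2))) = ⊤ := by
      refine top_unique ?_
      calc (⊤ : ℝ≥0∞) = ∫⁻ _ : ℝ, 1 := by simp
        _ ≤ _ := lintegral_mono fun x => by
          rw [← ENNReal.ofReal_one]
          refine ENNReal.ofReal_le_ofReal (Real.one_le_exp ?_)
          nlinarith [sq_nonneg x]
    rw [htop] at huniv
    by_cases hc : c = 0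
    · simp [hc] at huniv
    · rw [ENNReal.mul_top (by simpa using hc)] at huniv
      simp at huniv
  refine ⟨hb, ?_⟩
  have hv : (1 / b).toNNReal ≠ 0 := by simpa using hb
  have hv' : (((1 / b).toNNReal : ℝ≥0) : ℝ) = 1 / b := Real.coe_toNNReal _ (by positivity)
  set s : ℝ := (Real.sqrt (2 * Real.pi * (1 / b))) with hs
  have hs0 : 0 < s := by have := Real.pi_pos; positivity
  have hpdf : ∀ x, ENNReal.ofReal (Real.exp (-(b * x ^ 2 / 2))) =
      ENNReal.ofReal s * gaussianPDF 0 (1 / b).toNNReal x := by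
    intro x
    rw [gaussianPDF, ← ENNReal.ofReal_mul hs0.le, gaussianPDFReal, hv', ← mul_assoc,
      mul_inv_cancel₀ hs0.ne', one_mul, sub_zero]
    congr 2
    field_simp
  have hP : P = ((c : ℝ≥0∞) * ENNReal.ofReal s) • gaussianReal 0 (1 / b).toNNReal := by
    rw [h, gaussianReal_of_var_ne_zero _ hv]
    simp_rw [hpdf]
    ext B hB
    rw [withDensity_apply _ hB, Measure.smul_apply, withDensity_apply _ hB,
      Measure.restrict_smul, lintegral_const_mul _ (measurable_gaussianPDF _ _)]
    change _ * lintegral ((c : ℝ≥0∞) • _) _ = _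
    rw [lintegral_smul_measure, smul_eq_mul, smul_eq_mul]
    ring
  have h1 := congrArg (fun m : Measure ℝ => m Set.univ) hP
  simp only [measure_univ, Measure.smul_apply, smul_eq_mul, mul_one] at h1
  rw [hP, ← h1, one_smul]

/-- If the first order condition holds with a positive slope, then the prior is Gaussian. -/
theorem eq_gaussianReal_of_ae_integral_eq_zero {p a : ℝ} (hp1 : 1 ≤ p) (hp2 : p ≤ 2) (ha : 0 < a)
    {P : Measure ℝ} [IsProbabilityMeasure P]
    (h : ∀ᵐ y, ∫ x, gaussianPDFReal 0 1 (y - x) * signPow (p - 1) (x - a * y) ∂P = 0) :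
    a < 1 ∧ P = gaussianReal 0 (Real.toNNReal (a / (1 - a))) := by
  -- The constants `β` and `b` are those for which `(y - x)² / 2 = β (x - a y)² - b x² / 2 + (1 - a)
  -- y² / 2`.
  set β : ℝ := 1 / (2 * a) with hβ
  have hβ0 : 0 < β := by positivity
  set b : ℝ := (1 - a) / a with hb
  obtain ⟨L, hLc, hL0, hLm, hLF, ⟨A, hA⟩, hLK⟩ := exists_primitive_kernel hp1 hp2 hβ0
  have hs := measurable_signPow (p - 1)
  let e : ℝ → ℝ := fun x => Real.exp (b * x ^ 2 / 2)
  have he0 : ∀ x, 0 < e x := fun x => Real.exp_pos _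
  have hec : Continuous e := by fun_prop
  -- completing the square
  have hsq : ∀ x y, Real.exp (-β * (x - a * y) ^ 2) * e x =
      Real.exp (-((y - x) ^ 2 / 2)) * Real.exp ((1 - a) * y ^ 2 / 2) := by
    intro x y
    simp only [e]
    rw [← Real.exp_add, ← Real.exp_add]
    congr 1
    rw [hβ, hb]
    field_simp
    ring
  have hLe : ∀ x y, L (x - a * y) * e x ≤ A * Real.exp ((1 - a) * y ^ 2 / 2) := by
    intro x y
    have hA0 : 0 ≤ A := by
      have := (hL0 0).le.trans (hA 0)
      exact nonneg_of_mul_nonneg_left this (Real.exp_pos _)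
    calc L (x - a * y) * e x ≤ A * Real.exp (-β * (x - a * y) ^ 2) * e x := by
          have := (he0 x).le
          gcongr
          exact hA _
      _ = A * (Real.exp (-((y - x) ^ 2 / 2)) * Real.exp ((1 - a) * y ^ 2 / 2)) := by
          rw [mul_assoc, hsq]
      _ ≤ A * (1 * Real.exp ((1 - a) * y ^ 2 / 2)) := by
          gcongr
          exact Real.exp_le_one_iff.2 (by nlinarith [sq_nonneg (y - x)])
      _ = _ := by rw [one_mul]
  have hLi : ∀ y, Integrable (fun x => L (x - a * y) * e x) P := by
    intro y
    refine Integrable.of_bound (Continuous.aestronglyMeasurable (by fun_prop))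
      (A * Real.exp ((1 - a) * y ^ 2 / 2)) (Filter.Eventually.of_forall fun x => ?_)
    rw [Real.norm_of_nonneg (mul_nonneg (hL0 _).le (he0 _).le)]
    exact hLe x y
  let G : ℝ → ℝ → ℝ := fun y x => signPow (p - 1) (x - a * y) *
    Real.exp (-β * (x - a * y) ^ 2) * e x
  have hG : ∀ y x, G y x = (Real.sqrt (2 * Real.pi) * Real.exp ((1 - a) * y ^ 2 / 2)) *
      (gaussianPDFReal 0 1 (y - x) * signPow (p - 1) (x - a * y)) := by
    intro y x
    have hpi : Real.sqrt (2 * Real.pi) ≠ 0 := by have := Real.pi_pos; positivity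
    simp only [G]
    rw [mul_assoc, hsq, gaussianPDFReal_zero_one]
    field_simp
  have hG0 : ∀ᵐ y, ∫ x, G y x ∂P = 0 := by
    filter_upwards [h] with y hy
    simp_rw [hG]
    rw [integral_const_mul, hy, mul_zero]
  have hGb : ∀ y x, ‖G y x‖ ≤ Real.exp ((1 - a) * y ^ 2 / 2) *
      Real.exp (1 / 2 + |1 - a| * |y|) := by
    intro y x
    simp only [G]
    rw [mul_assoc, hsq, norm_mul, norm_mul, Real.norm_of_nonneg (Real.exp_pos _).le,
      Real.norm_of_nonneg (Real.exp_pos _).le, Real.norm_eq_abs]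
    calc _ ≤ Real.exp |x - a * y| * (Real.exp (-((y - x) ^ 2 / 2)) *
          Real.exp ((1 - a) * y ^ 2 / 2)) := by
          gcongr
          exact (abs_signPow_le _ _).trans (abs_rpow_le_exp hp1 hp2 _)
      _ = Real.exp ((1 - a) * y ^ 2 / 2) * Real.exp (|x - a * y| + -((y - x) ^ 2 / 2)) := by
          rw [Real.exp_add]; ring
      _ ≤ _ := by
          refine mul_le_mul_of_nonneg_left (Real.exp_le_exp.2 ?_) (Real.exp_pos _).le
          have h1 : |x - a * y| ≤ |y - x| + |1 - a| * |y| := by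
            have h2 := abs_add_le (x - y) ((1 - a) * y)
            rw [abs_mul, abs_sub_comm x y] at h2
            have h3 : x - y + (1 - a) * y = x - a * y := by ring
            rwa [h3] at h2
          have h4 : (y - x) ^ 2 = |y - x| ^ 2 := (sq_abs _).symm
          nlinarith [sq_nonneg (|y - x| - 1)]
  have hGm : Measurable (Function.uncurry G) := by
    unfold Function.uncurry
    fun_prop
  -- The fundamental theorem of calculus along `y ↦ x - a * y`, with chain-rule factor `-a`.
  have hpt : ∀ x η, L (x - a * η) * e x - L x * e x = a * ∫ y in (0 : ℝ)..η, G y x := by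
    intro x η
    rw [← sub_mul, hLK x (x - a * η), intervalIntegral.integral_mul_const, ← mul_assoc]
    congr 1
    have h1 := intervalIntegral.integral_comp_sub_mul (a := (0 : ℝ)) (b := η)
      (fun u => signPow (p - 1) u * Real.exp (-β * u ^ 2)) ha.ne' x
    rw [h1, mul_zero, sub_zero, smul_eq_mul, ← mul_assoc, mul_inv_cancel₀ ha.ne', one_mul,
      intervalIntegral.integral_symm, neg_neg]
  -- Integrating over `y` turns the almost everywhere condition into an identity valid for every
  -- translation.
  have hconst : ∀ η, ∫ x, L (x - a * η) * e x ∂P = ∫ x, L x * e x ∂P := by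
    intro η
    have hL0i : Integrable (fun x => L x * e x) P := by simpa using hLi 0
    rw [← sub_eq_zero, ← integral_sub (hLi η) hL0i]
    simp_rw [hpt]
    rw [integral_const_mul]
    refine mul_eq_zero_of_right _ ?_
    rw [← intervalIntegral_integral_swap]
    · refine intervalIntegral.integral_zero_ae ?_
      filter_upwards [hG0] with y hy _ using hy
    · have hcont : Continuous fun y => Real.exp ((1 - a) * y ^ 2 / 2) *
          Real.exp (1 / 2 + |1 - a| * |y|) := by fun_prop
      have hgi : Integrable (fun z : ℝ × ℝ => (Real.exp ((1 - a) * z.1 ^ 2 / 2) *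
          Real.exp (1 / 2 + |1 - a| * |z.1|)) * 1) ((volume.restrict (Set.uIoc 0 η)).prod P) :=
        Integrable.mul_prod (hcont.integrableOn_uIoc) (integrable_const 1)
      refine hgi.mono' hGm.aestronglyMeasurable (Filter.Eventually.of_forall fun z => ?_)
      rw [mul_one]
      exact hGb z.1 z.2
  set ν : Measure ℝ := P.withDensity fun x => ENNReal.ofReal (e x) with hν
  have hem : Measurable fun x => ENNReal.ofReal (e x) := by fun_prop
  have hνc : ∀ η, ∫⁻ x, ENNReal.ofReal (L (x - η)) ∂ν =
      ((∫ x, L x * e x ∂P).toNNReal : ℝ≥0) := by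
    intro η
    have h1 : η = a * (η / a) := by field_simp
    rw [h1, hν, lintegral_withDensity_eq_lintegral_mul _ hem
      (g := fun x => ENNReal.ofReal (L (x - a * (η / a)))) (by have := hLc.measurable; fun_prop),
      ← hconst (η / a)]
    change _ = ENNReal.ofReal _
    rw [ofReal_integral_eq_lintegral_ofReal (hLi _)
      (Filter.Eventually.of_forall fun x => mul_nonneg (hL0 _).le (he0 _).le)]
    congr 1 with x
    rw [Pi.mul_apply, ← ENNReal.ofReal_mul (he0 _).le, mul_comm]
  obtain ⟨c, hc⟩ := eq_smul_volume_of_translate_const hLc hL0 hLm hLF hνc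
  have hPν : P = (c • (volume : Measure ℝ)).withDensity
      fun x => ENNReal.ofReal (Real.exp (-(b * x ^ 2 / 2))) := by
    rw [← hc, hν, ← withDensity_mul _ hem (by fun_prop)]
    have : ((fun x => ENNReal.ofReal (e x)) * fun x =>
        ENNReal.ofReal (Real.exp (-(b * x ^ 2 / 2)))) = 1 := by
      ext x
      rw [Pi.mul_apply, ← ENNReal.ofReal_mul (he0 _).le, ← Real.exp_add]
      simp
    rw [this, withDensity_one]
  obtain ⟨hb0, hPg⟩ := eq_gaussianReal_of_withDensity hPν
  refine ⟨?_, ?_⟩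
  · rw [hb, div_pos_iff_of_pos_right ha] at hb0
    linarith
  · rw [hPg, hb, one_div_div]

end PositiveSlope

/-! ### Gaussian priors: linear shrinkage is optimal -/

section Converse

variable {Ω : Type*} [MeasurableSpace Ω] {μ : Measure Ω} [IsProbabilityMeasure μ] {X Z : Ω → ℝ}

/-- Shifting an independent symmetric noise can only increase its `L^p` size. -/
lemma lintegral_abs_rpow_le_of_indepFun {p : ℝ} (hp1 : 1 ≤ p) {W Y : Ω → ℝ} {γ : Measure ℝ}
    (hW : HasLaw W γ μ) (hγ : γ.map (fun x => -x) = γ) (hY : AEMeasurable Y μ)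
    (hWY : IndepFun W Y μ) {k : ℝ → ℝ} (hk : Measurable k) :
    ∫⁻ ω, ENNReal.ofReal (|W ω| ^ p) ∂μ ≤ ∫⁻ ω, ENNReal.ofReal (|W ω - k (Y ω)| ^ p) ∂μ := by
  have hprob := Measure.isProbabilityMeasure_map hY
  have hγp : IsProbabilityMeasure γ := by
    rw [← hW.map_eq]
    exact Measure.isProbabilityMeasure_map hW.aemeasurable
  have hlaw : HasLaw (fun ω => (W ω, Y ω)) (γ.prod (μ.map Y)) μ :=
    (indepFun_iff_hasLaw_prodMk_prod hW ⟨hY, rfl⟩).1 hWY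
  -- Given `Y`, the correction is a constant `c`; by symmetry of `γ` the shifts by `c` and `-c` cost
  -- the same, and `w` is the midpoint of `w - c` and `w + c`.
  have hshift : ∀ c : ℝ, ∫⁻ w, ENNReal.ofReal (|w| ^ p) ∂γ ≤
      ∫⁻ w, ENNReal.ofReal (|w - c| ^ p) ∂γ := by
    intro c
    have hsym : ∫⁻ w, ENNReal.ofReal (|w + c| ^ p) ∂γ = ∫⁻ w, ENNReal.ofReal (|w - c| ^ p) ∂γ := by
      conv_lhs => rw [← hγ]
      rw [lintegral_map (by fun_prop) (by fun_prop)]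
      congr 1 with w
      rw [← abs_neg]
      congr 3
      ring
    have havg : ∫⁻ w, ENNReal.ofReal (|w - c| ^ p) ∂γ =
        ∫⁻ w, (ENNReal.ofReal (1 / 2) * ENNReal.ofReal (|w - c| ^ p) +
          ENNReal.ofReal (1 / 2) * ENNReal.ofReal (|w + c| ^ p)) ∂γ := by
      rw [lintegral_add_left (by fun_prop), lintegral_const_mul' _ _ ENNReal.ofReal_ne_top,
        lintegral_const_mul' _ _ ENNReal.ofReal_ne_top, hsym, ← add_mul,
        ← ENNReal.ofReal_add (by norm_num) (by norm_num)]
      norm_num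
    rw [havg]
    refine lintegral_mono fun w => ?_
    have hnn : ∀ x : ℝ, 0 ≤ |x| ^ p := fun x => Real.rpow_nonneg (abs_nonneg _) _
    simp only
    rw [← ENNReal.ofReal_mul (by norm_num), ← ENNReal.ofReal_mul (by norm_num),
      ← ENNReal.ofReal_add (mul_nonneg (by norm_num) (hnn _)) (mul_nonneg (by norm_num) (hnn _))]
    refine ENNReal.ofReal_le_ofReal ?_
    have h3 := abs_rpow_add_le hp1 (a := 1 / 2) (b := 1 / 2) (by norm_num) (by norm_num)
      (by norm_num) (w - c) (w + c)
    have e : 1 / 2 * (w - c) + 1 / 2 * (w + c) = w := by ring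
    rwa [e] at h3
  have h1 := hlaw.lintegral_comp (f := fun z => ENNReal.ofReal (|z.1| ^ p)) (by fun_prop)
  have h2 := hlaw.lintegral_comp (f := fun z => ENNReal.ofReal (|z.1 - k z.2| ^ p)) (by fun_prop)
  simp only at h1 h2
  rw [h1, h2, lintegral_prod_symm' _ (by fun_prop), lintegral_prod_symm' _ (by fun_prop)]
  exact lintegral_mono fun y => hshift (k y)

/-- For a Gaussian prior the linear shrinkage estimator is optimal. -/
theorem isOptimalEstimator_of_hasLaw_gaussianReal {p a : ℝ} (hp1 : 1 ≤ p) (ha0 : 0 ≤ a)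
    (ha1 : a < 1) (hX : HasLaw X (gaussianReal 0 (Real.toNNReal (a / (1 - a)))) μ)
    (hZ : HasLaw Z (gaussianReal 0 1) μ) (hXZ : IndepFun X Z μ) :
    IsOptimalEstimator μ p X (X + Z) (fun y => a * y) := by
  refine ⟨by fun_prop, fun g hg => ?_⟩
  have hXm := hX.aemeasurable
  have hZm := hZ.aemeasurable
  have hXg : HasGaussianLaw X μ := hX.hasGaussianLaw
  have hZg : HasGaussianLaw Z μ := hZ.hasGaussianLaw
  have hXZg : HasGaussianLaw (fun ω => (X ω, Z ω)) μ := hXZ.hasGaussianLaw hXg hZg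
  let T : ℝ × ℝ →L[ℝ] ℝ × ℝ :=
    ((1 - a) • ContinuousLinearMap.fst ℝ ℝ ℝ - a • ContinuousLinearMap.snd ℝ ℝ ℝ).prod
      (ContinuousLinearMap.fst ℝ ℝ ℝ + ContinuousLinearMap.snd ℝ ℝ ℝ)
  -- The error `X - a * (X + Z)`, written as a linear image of the Gaussian pair.
  let W : Ω → ℝ := fun ω => (1 - a) * X ω - a * Z ω
  have hWYg : HasGaussianLaw (fun ω => (W ω, (X + Z) ω)) μ := hXZg.map_fun T
  have hXv : Var[X; μ] = a / (1 - a) := by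
    rw [hX.variance_eq, variance_id_gaussianReal, Real.coe_toNNReal]
    exact div_nonneg ha0 (by linarith)
  have hZv : Var[Z; μ] = 1 := by
    rw [hZ.variance_eq, variance_id_gaussianReal]; rfl
  have hcov0 : cov[X, Z; μ] = 0 := hXZ.covariance_eq_zero hXg.memLp_two hZg.memLp_two
  -- The covariance is `(1 - a) Var X - a Var Z`, which vanishes exactly for `Var X = a / (1 - a)`;
  -- joint normality upgrades this to independence.
  have hcov : cov[W, X + Z; μ] = 0 := by
    have hX2 := hXg.memLp_two
    have hZ2 := hZg.memLp_two
    have hW : W = (fun ω => (1 - a) * X ω) - fun ω => a * Z ω := rfl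
    rw [hW, covariance_sub_left (hX2.const_mul _) (hZ2.const_mul _) (hX2.add hZ2),
      covariance_const_mul_left, covariance_const_mul_left, covariance_add_right hX2 hX2 hZ2,
      covariance_add_right hZ2 hX2 hZ2, covariance_comm Z X, hcov0, covariance_self hXm,
      covariance_self hZm, hXv, hZv]
    have : 1 - a ≠ 0 := by linarith
    field_simp
    ring
  have hind : IndepFun W (X + Z) μ := hWYg.indepFun_of_covariance_eq_zero hcov
  have hW : HasLaw W (μ.map W) μ := ⟨by fun_prop, rfl⟩
  have hWmean : μ[W] = 0 := by
    have h1 : μ[X] = 0 := by rw [hX.integral_eq, integral_id_gaussianReal]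
    have h2 : μ[Z] = 0 := by rw [hZ.integral_eq, integral_id_gaussianReal]
    rw [integral_sub (hXg.integrable.const_mul _) (hZg.integrable.const_mul _),
      integral_const_mul, integral_const_mul, h1, h2]
    simp
  have hsym : (μ.map W).map (fun x => -x) = μ.map W := by
    rw [hWYg.fst.map_eq_gaussianReal, hWmean, gaussianReal_map_neg, neg_zero]
  have h := lintegral_abs_rpow_le_of_indepFun hp1 hW hsym (hXm.add hZm) hind
    (k := fun y => g y - a * y) (by fun_prop)
  unfold _root_.bayesRisk
  refine (le_of_eq ?_).trans (h.trans (le_of_eq ?_))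
  · congr 1 with ω
    simp only [W, Pi.add_apply]
    congr 3
    ring
  · congr 1 with ω
    simp only [W, Pi.add_apply]
    congr 3
    ring

end Converse

/-! ### The characterization -/

theorem mainTheorem2 {Ω : Type*} [MeasurableSpace Ω] (μ : Measure Ω) [IsProbabilityMeasure μ]
    (p : ℝ) (hp1 : 1 ≤ p) (hp2 : p ≤ 2)
    (X Z : Ω → ℝ) (hX : AEMeasurable X μ)
    (hZ : HasLaw Z (gaussianReal 0 1) μ) (hXZ : IndepFun X Z μ) :
    ((∃ a : ℝ, IsOptimalEstimator μ p X (X + Z) (fun y => a * y)) ↔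
      ∃ v : ℝ≥0, HasLaw X (gaussianReal 0 v) μ) ∧
    ∀ a : ℝ, IsOptimalEstimator μ p X (X + Z) (fun y => a * y) ↔
      (0 ≤ a ∧ a < 1 ∧ HasLaw X (gaussianReal 0 (Real.toNNReal (a / (1 - a)))) μ) := by
  have main : ∀ a : ℝ, IsOptimalEstimator μ p X (X + Z) (fun y => a * y) ↔
      (0 ≤ a ∧ a < 1 ∧ HasLaw X (gaussianReal 0 (Real.toNNReal (a / (1 - a)))) μ) := by
    intro a
    refine ⟨fun h => ?_, fun ⟨ha0, ha1, hXl⟩ =>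
      isOptimalEstimator_of_hasLaw_gaussianReal hp1 ha0 ha1 hXl hZ hXZ⟩
    have ha := nonneg_of_isOptimal hp1 hX hZ hXZ h
    refine ⟨ha, ?_⟩
    rcases ha.eq_or_lt with rfl | ha
    · have h0 := ae_eq_zero_of_isOptimal_zero hp1 hp2 hX hZ hXZ h
      refine ⟨one_pos, ?_⟩
      rw [zero_div, Real.toNNReal_zero, gaussianReal_zero_var]
      exact hasLaw_dirac_of_ae_eq h0
    · have hprob := Measure.isProbabilityMeasure_map hX
      have hfoc := abs_integral_signPow_mul_gaussianPDFReal_le hp1 hX hZ hXZ h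
      obtain ⟨ha1, hP⟩ := eq_gaussianReal_of_ae_integral_eq_zero hp1 hp2 ha (P := μ.map X) (by
        filter_upwards [hfoc, ae_measure_singleton_mul_eq_zero (P := μ.map X) ha.ne'] with y h1 h2
        rw [Measure.real, h2, ENNReal.toReal_zero, mul_zero] at h1
        exact abs_eq_zero.1 (le_antisymm h1 (abs_nonneg _)))
      exact ⟨ha1, hX, hP⟩
  refine ⟨⟨fun ⟨a, ha⟩ => ⟨_, ((main a).1 ha).2.2⟩, fun ⟨v, hv⟩ => ?_⟩, main⟩
  have hv0 : (0 : ℝ) ≤ v := v.2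
  -- The solution of `a / (1 - a) = v`.
  refine ⟨v / (1 + v), (main _).2 ⟨by positivity, ?_, ?_⟩⟩
  · rw [div_lt_one (by positivity)]
    linarith
  · have e : (v : ℝ) / (1 + v) / (1 - v / (1 + v)) = v := by
      field_simp
      ring
    rw [e, Real.toNNReal_coe]
    exact hv
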